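/- An instance $(A,c,f,v)$ consists of a finite set $A$ of $n$ actions, costs $c(a)\ge 0$ and success probabilities $f(a)\in[0,1]$ for $a\in A$, where some action has cost $0$, and an inspection cost $v:2^A\to\mathbb R_{\ge 0}$ with $v(\emptyset)=0$ and $v(S)\le v(T)$ for $S\subseteq T$. An inspection scheme $(i,\alpha,p)$ consists of a suggested action $i\in A$, a contract $\alpha\in[0,1]$ and a probability distribution $p$ on $2^A$. Under it, the agent's expected utility is $\alpha f(i)-c(i)$ if she takes action $i$, and $\alpha f(j)\bigl(1-\sum_{S:\{i,j\}\cap S\ne\emptyset}p(S)\bigr)-c(j)$ if she takes an action $j\ne i$. The scheme is incentive-compatible (IC) if action $i$ maximizes the agent's expected utility. It is optimal if it is IC and maximizes the principal's expected utility $(1-\alpha)f(i)-\sum_{S\subseteq A}p(S)v(S)$ among all IC schemes. The function $v$ is submodular if $v(S\cup\{a\})-v(S)\ge v(T\cup\{a\})-v(T)$ for all $S\subseteq T\subseteq A$ and $a\in A$. Theorem. For every instance $(A,c,f,v)$ with submodular $v$ there is an optimal IC inspection scheme $(i,\alpha,p)$ such that $p$ is supported on at most $n+1$ sets. Moreover,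 such a scheme can be computed exactly in time polynomial in $n$ using value queries to $v$: there are one program for a real random access machine (unit-cost arithmetic $+,-,\times,/$, square roots and comparisons on real numbers, rational constants, and a value oracle that returns $v(S)$ for a queried set $S$) and one polynomial $T$ such that, for every instance with $A=\{0,\dots,n-1\}$ and $v$ submodular, the program, given $n$, $c$ and $f$ and access to $v$ only through the oracle, halts after at most $T(n)$ steps and outputs an optimal IC scheme $(i,\alpha,p)$, with $p$ given as an explicit list of at most $n+1$ sets with their probabilities. -/

import Mathlib

namespace Inspection

/-! ### Contracts with inspections -/

/-- An instance `(A, c, f, v)`: action costs `c`, success probabilities `f`, a null action of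
cost `0`, and a normalized monotone inspection cost `v` (which is then nonnegative). -/
structure Instance (A : Type*) where
  c : A → ℝ
  f : A → ℝ
  v : Finset A → ℝ
  c_nonneg : ∀ a, 0 ≤ c a
  f_nonneg : ∀ a, 0 ≤ f a
  f_le_one : ∀ a, f a ≤ 1
  exists_null : ∃ a, c a = 0
  v_empty : v ∅ = 0
  v_mono : ∀ S T, S ⊆ T → v S ≤ v T

/-- Decreasing marginals: `v(i | S) ≥ v(i | T)` whenever `S ⊆ T`. -/
def IsSubmodular {A : Type*} [DecidableEq A] (v : Finset A → ℝ) : Prop :=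
  ∀ S T : Finset A, S ⊆ T → ∀ i : A, v (insert i T) - v T ≤ v (insert i S) - v S

/-- A randomized inspection scheme `(i, α, p)`: a suggested action `i`, a contract `α ∈ [0,1]`,
and a probability distribution `p` over the subsets of `A`. -/
structure Scheme (A : Type*) [Fintype A] where
  action : A
  contract : ℝ
  p : Finset A → ℝ
  contract_nonneg : 0 ≤ contract
  contract_le_one : contract ≤ 1
  p_nonneg : ∀ S, 0 ≤ p S
  p_sum : ∑ S, p S = 1

section Utilities

variable {A : Type*} [Fintype A] [DecidableEq A]

/-- Probability that the inspected set meets `{i, j}`, where `i` is the suggested action. -/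
def Scheme.caught (σ : Scheme A) (j : A) : ℝ :=
  ∑ S with (({σ.action, j} : Finset A) ∩ S).Nonempty, σ.p S

/-- Expected utility of the agent when she takes action `j`. -/
def Instance.agentUtility (I : Instance A) (σ : Scheme A) (j : A) : ℝ :=
  if j = σ.action then σ.contract * I.f j - I.c j
  else σ.contract * I.f j * (1 - σ.caught j) - I.c j

/-- Expected utility of the principal when the agent takes action `j`. -/
def Instance.principalUtility (I : Instance A) (σ : Scheme A) (j : A) : ℝ :=
  if j = σ.action then (1 - σ.contract) * I.f j - ∑ S, σ.p S * I.v S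
  else (1 - σ.contract * (1 - σ.caught j)) * I.f j - ∑ S, σ.p S * I.v S

/-- Incentive compatibility: the suggested action is a best response of the agent. -/
def Instance.IsIC (I : Instance A) (σ : Scheme A) : Prop :=
  ∀ j : A, I.agentUtility σ j ≤ I.agentUtility σ σ.action

/-- `σ` is an optimal randomized incentive-compatible scheme. -/
def Instance.IsOptimalIC (I : Instance A) (σ : Scheme A) : Prop :=
  I.IsIC σ ∧ ∀ τ : Scheme A, I.IsIC τ →
    I.principalUtility τ τ.action ≤ I.principalUtility σ σ.action

end Utilities

/-! ### Real random access machine with a value oracle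

Programs of a small imperative language. The memory consists of integer arrays and real arrays
with indirect addressing; a program mentions finitely many arrays. The primitives on integers are
addition and truncated subtraction, those on reals are the field operations, square root (exact
optima need not be rational in the data) and rational constants; control flow depends on
comparisons. The set function is accessed through value queries only. -/

/-- Memory: `nat a i` and `real a i` are the entries with index `i` of the arrays named `a`. -/
structure Store where
  nat : ℕ → ℕ → ℕ
  real : ℕ → ℕ → ℝ

/-- Integer expressions. -/
inductive NExp where
  | const (k : ℕ)
  | get (a : ℕ) (i : NExp)
  | add (x y : NExp)
  | sub (x y : NExp)

/-- Real expressions. -/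
inductive RExp where
  | const (q : ℚ)
  | get (a : ℕ) (i : NExp)
  | add (x y : RExp)
  | sub (x y : RExp)
  | mul (x y : RExp)
  | div (x y : RExp)
  | sqrt (x : RExp)

/-- Tests. -/
inductive BExp where
  | nle (x y : NExp)
  | rle (x y : RExp)
  | not (b : BExp)
  | and (b d : BExp)

def NExp.eval (s : Store) : NExp → ℕ
  | const k => k
  | get a i => s.nat a (i.eval s)
  | add x y => x.eval s + y.eval s
  | sub x y => x.eval s - y.eval s

noncomputable def RExp.eval (s : Store) : RExp → ℝ
  | const q => (q : ℝ)
  | get a i => s.real a (i.eval s)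
  | add x y => x.eval s + y.eval s
  | sub x y => x.eval s - y.eval s
  | mul x y => x.eval s * y.eval s
  | div x y => x.eval s / y.eval s
  | sqrt x => Real.sqrt (x.eval s)

def BExp.eval (s : Store) : BExp → Prop
  | nle x y => x.eval s ≤ y.eval s
  | rle x y => x.eval s ≤ y.eval s
  | not b => ¬ b.eval s
  | and b d => b.eval s ∧ d.eval s

/-- Number of operations in an expression; each one takes one step. -/
def NExp.cost : NExp → ℕ
  | const _ => 1
  | get _ i => i.cost + 1
  | add x y => x.cost + y.cost + 1
  | sub x y => x.cost + y.cost + 1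

def RExp.cost : RExp → ℕ
  | const _ => 1
  | get _ i => i.cost + 1
  | add x y => x.cost + y.cost + 1
  | sub x y => x.cost + y.cost + 1
  | mul x y => x.cost + y.cost + 1
  | div x y => x.cost + y.cost + 1
  | sqrt x => x.cost + 1

def BExp.cost : BExp → ℕ
  | nle x y => x.cost + y.cost + 1
  | rle x y => x.cost + y.cost + 1
  | not b => b.cost + 1
  | and b d => b.cost + d.cost + 1

/-- Commands. `query a o r i` asks for the value of the set whose indicator is stored in the
integer array `a` from index `o` on, and writes the answer to entry `i` of the real array `r`. -/
inductive Cmd where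
  | skip
  | setN (a : ℕ) (i e : NExp)
  | setR (a : ℕ) (i : NExp) (e : RExp)
  | query (a : ℕ) (o : NExp) (r : ℕ) (i : NExp)
  | seq (C D : Cmd)
  | ite (b : BExp) (C D : Cmd)
  | whileDo (b : BExp) (C : Cmd)

def Store.writeN (s : Store) (a i k : ℕ) : Store where
  nat := fun a' i' => if a' = a ∧ i' = i then k else s.nat a' i'
  real := s.real

noncomputable def Store.writeR (s : Store) (a i : ℕ) (x : ℝ) : Store where
  nat := s.nat
  real := fun a' i' => if a' = a ∧ i' = i then x else s.real a' i'

/-- The subset of `{0, …, n - 1}` whose indicator (nonzero means member) is stored in the integer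
array `a` from index `o` on. -/
def Store.readSet (s : Store) (n a o : ℕ) : Finset (Fin n) :=
  {j | s.nat a (o + j.val) ≠ 0}

/-- `Exec v C s t s'`: with value oracle `v` and started in `s`, the program `C` halts in `s'`
after `t` steps. A value query takes one step plus `n` steps for passing the set. -/
inductive Exec {n : ℕ} (v : Finset (Fin n) → ℝ) : Cmd → Store → ℕ → Store → Prop
  | skip (s) : Exec v .skip s 1 s
  | setN (a i e s) : Exec v (.setN a i e) s (i.cost + e.cost + 1)
      (s.writeN a (i.eval s) (e.eval s))
  | setR (a i e s) : Exec v (.setR a i e) s (i.cost + e.cost + 1)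
      (s.writeR a (i.eval s) (e.eval s))
  | query (a o r i s) : Exec v (.query a o r i) s (o.cost + i.cost + n + 1)
      (s.writeR r (i.eval s) (v (s.readSet n a (o.eval s))))
  | seq {C D s s₁ s₂ t₁ t₂} : Exec v C s t₁ s₁ → Exec v D s₁ t₂ s₂ →
      Exec v (.seq C D) s (t₁ + t₂) s₂
  | ite_true {b C D s s₁ t} : b.eval s → Exec v C s t s₁ →
      Exec v (.ite b C D) s (b.cost + t) s₁
  | ite_false {b C D s s₁ t} : ¬ b.eval s → Exec v D s t s₁ →
      Exec v (.ite b C D) s (b.cost + t) s₁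
  | while_true {b C s s₁ s₂ t₁ t₂} : b.eval s → Exec v C s t₁ s₁ →
      Exec v (.whileDo b C) s₁ t₂ s₂ → Exec v (.whileDo b C) s (b.cost + t₁ + t₂) s₂
  | while_false {b C s} : ¬ b.eval s → Exec v (.whileDo b C) s b.cost s

/-- Initial memory for an instance on the actions `0, …, n - 1`: the number `n` in integer array
`0`, the costs `c` in real array `0`, the probabilities `f` in real array `1`, and `0` elsewhere.
The function `v` and the name of a null action are not part of the input. -/
noncomputable def Instance.input {n : ℕ} (I : Instance (Fin n)) : Store where
  nat := fun a i => if a = 0 ∧ i = 0 then n else 0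
  real := fun a i =>
    if h : i < n then (if a = 0 then I.c ⟨i, h⟩ else if a = 1 then I.f ⟨i, h⟩ else 0) else 0

/-- The final memory `s` describes the scheme `σ` by an explicit list of `m` sets with their
probabilities: integer array `1` starts with the suggested action and `m`, integer array `2` holds
the indicators of the sets one after the other, real array `2` starts with the contract, and real
array `3` holds the probabilities. All sets not listed have probability `0`. -/
def Store.Describes {n : ℕ} (s : Store) (σ : Scheme (Fin n)) (m : ℕ) : Prop :=
  s.nat 1 0 = σ.action.val ∧ s.nat 1 1 = m ∧ s.real 2 0 = σ.contract ∧
    ∀ S : Finset (Fin n),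
      σ.p S = ∑ t ∈ Finset.range m, if s.readSet n 2 (t * n) = S then s.real 3 t else 0

end Inspection

/-!
Fix the suggested action `i` and the contract `α`. Incentive compatibility says that each other
action `j` is caught with at least a certain probability `q j`. Inspecting `i` catches everything,
so inspecting `S` is worth at most `min (v {i}) (v S)`, which is again monotone and submodular.
The cheapest distribution covering each `j` with probability `q j` is the one given by the greedy
algorithm: list the actions by decreasing `q` and inspect the initial segments with the successive
decrements of `q` as probabilities (`Instance.bestScheme`). With the empty set these are at most
`n + 1` sets. Optimality is weak duality with the greedy vertex of the base polytope
(`sum_gain_le_of_cover`, `Instance.IsIC.minCost_le`), and the cost is the Lovász extension at `q`.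

It remains to choose `i` and `α`. Each `q j` is the positive part of an affine function of `1 / α`.
Between neighbouring crossings of these functions the order of the `q j` is constant, so the cost
has the form `P + Q / α` (`Instance.minCost_eq_on_piece`), and the utility
`(1 - α) * f i - P - Q / α` is maximal at `√(Q / f i)`, moved into the piece. Instead of sorting
the crossings, one considers all pairs of them: a pair of neighbours yields this maximizer, every
other pair some feasible contract, which does no harm (`Instance.IsIC.exists_candidate`).

The algorithm evaluates these polynomially many candidates and keeps the best. It is written in a
language `Prog` whose loops all run through `0, …, n - 1`. Such a program computes a function
`Prog.run` on stores, and it translates to the machine language with a polynomial time bound that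
can be read off its text (`Prog.exec_code`); what is left is to compute `Prog.run`.
-/

namespace Inspection

/-! ### The greedy algorithm for a monotone submodular function -/

section Greedy

variable {A K : Type*} [Fintype A] [LinearOrder K]

/-- The gain in `w` when `k` is added to all elements that come before it in the order given by
the key `r`; these gains form the greedy vertex of the base polytope of `w`. -/
def gain (w : Finset A → ℝ) (r : A → K) (k : A) : ℝ :=
  w {j | r j ≤ r k} - w {j | r j < r k}

/-- The value following `q k` when the values of `q` are listed in the order of the key `r`,
with `0` after the last one. -/
def nextLevel (q : A → ℝ) (r : A → K) (k : A) : ℝ :=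
  Finset.fold max 0 q {j | r k < r j}

/-- The sum of the values of `w` on the initial segments of the order `r`, weighted by the
successive decrements of `q`. If `q` decreases along `r`, this is the Lovász extension of `w`
at `q`. -/
def lovasz (w : Finset A → ℝ) (q : A → ℝ) (r : A → K) : ℝ :=
  ∑ k, (q k - nextLevel q r k) * w {j | r j ≤ r k}

theorem nextLevel_le_iff {q : A → ℝ} {r : A → K} {k : A} {x : ℝ} :
    nextLevel q r k ≤ x ↔ 0 ≤ x ∧ ∀ j, r k < r j → q j ≤ x := by
  simp [nextLevel, Finset.fold_max_le]

theorem decrement_nonneg {q : A → ℝ} (hq : ∀ j, 0 ≤ q j) {r : A → K}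
    (hqr : ∀ j k, r j ≤ r k → q k ≤ q j) (k : A) : 0 ≤ q k - nextLevel q r k :=
  sub_nonneg.2 (nextLevel_le_iff.2 ⟨hq k, fun _ hj => hqr _ _ hj.le⟩)

variable [DecidableEq A]

theorem insert_lt_eq_le {r : A → K} (hr : Function.Injective r) (a : A) :
    insert a ({j | r j < r a} : Finset A) = ({j | r j ≤ r a} : Finset A) := by
  ext j
  simp only [Finset.mem_insert, Finset.mem_filter, Finset.mem_univ, true_and, le_iff_lt_or_eq,
    hr.eq_iff]
  tauto

/-- The greedy vector lies in the base polytope: this is where submodularity is used. -/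
theorem sum_gain_le {w : Finset A → ℝ} (hw : IsSubmodular w) (h0 : w ∅ = 0) {r : A → K}
    (hr : Function.Injective r) (S : Finset A) : ∑ k ∈ S, gain w r k ≤ w S := by
  induction S using Finset.induction_on_max_value r with
  | empty => simp [h0]
  | insert a s ha hmax ih =>
    rw [Finset.sum_insert ha]
    have hsub : s ⊆ ({j | r j < r a} : Finset A) := by
      intro x hx
      have hne : r x ≠ r a := fun h => ha (hr h ▸ hx)
      simpa using lt_of_le_of_ne (hmax x hx) hne
    have := hw s _ hsub a
    rw [insert_lt_eq_le hr] at this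
    have hg : gain w r a = w {j | r j ≤ r a} - w {j | r j < r a} := rfl
    linarith

theorem sum_gain_of_lower {w : Finset A → ℝ} (h0 : w ∅ = 0) {r : A → K}
    (hr : Function.Injective r) (S : Finset A) (hS : ∀ j k, k ∈ S → r j ≤ r k → j ∈ S) :
    ∑ k ∈ S, gain w r k = w S := by
  induction S using Finset.induction_on_max_value r with
  | empty => simp [h0]
  | insert a s ha hmax ih =>
    have hs : s = ({j | r j < r a} : Finset A) := by
      ext x
      constructor
      · intro hx
        have hne : r x ≠ r a := fun h => ha (hr h ▸ hx)
        simpa using lt_of_le_of_ne (hmax x hx) hne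
      · intro hx
        have hx' : r x < r a := by simpa using hx
        rcases Finset.mem_insert.1 (hS x a (Finset.mem_insert_self a s) hx'.le) with h | h
        · exact absurd hx' (h ▸ lt_irrefl _)
        · exact h
    have hlow : ∀ j k, k ∈ s → r j ≤ r k → j ∈ s := by
      intro j k hk hjk
      rw [hs] at hk ⊢
      simp only [Finset.mem_filter, Finset.mem_univ, true_and] at hk ⊢
      exact lt_of_le_of_lt hjk hk
    rw [Finset.sum_insert ha, ih hlow, gain, ← insert_lt_eq_le hr, ← hs]
    ring

theorem sum_decrement_of_upper {q : A → ℝ} (hq : ∀ j, 0 ≤ q j) {r : A → K}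
    (hr : Function.Injective r) (hqr : ∀ j k, r j ≤ r k → q k ≤ q j) (S : Finset A)
    (hS : ∀ j k, k ∈ S → r k ≤ r j → j ∈ S) :
    ∑ k ∈ S, (q k - nextLevel q r k) = Finset.fold max 0 q S := by
  induction S using Finset.induction_on_min_value r with
  | empty => simp
  | insert a s ha hmin ih =>
    have hs : s = ({j | r a < r j} : Finset A) := by
      ext x
      constructor
      · intro hx
        have hne : r a ≠ r x := fun h => ha (hr h ▸ hx)
        simpa using lt_of_le_of_ne (hmin x hx) hne
      · intro hx
        have hx' : r a < r x := by simpa using hx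
        rcases Finset.mem_insert.1 (hS x a (Finset.mem_insert_self a s) hx'.le) with h | h
        · exact absurd hx' (h ▸ lt_irrefl _)
        · exact h
    have hup : ∀ j k, k ∈ s → r k ≤ r j → j ∈ s := by
      intro j k hk hjk
      rw [hs] at hk ⊢
      simp only [Finset.mem_filter, Finset.mem_univ, true_and] at hk ⊢
      exact lt_of_lt_of_le hk hjk
    have hle : Finset.fold max 0 q s ≤ q a :=
      Finset.fold_max_le _ |>.2 ⟨hq a, fun x hx => hqr _ _ (hmin x hx)⟩
    rw [Finset.sum_insert ha, ih hup, Finset.fold_insert ha, max_eq_left hle, nextLevel, ← hs]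
    ring

/-- The weighted initial segments cover each element `j` with total weight exactly `q j`. -/
theorem sum_decrement_ge {q : A → ℝ} (hq : ∀ j, 0 ≤ q j) {r : A → K}
    (hr : Function.Injective r) (hqr : ∀ j k, r j ≤ r k → q k ≤ q j) (j : A) :
    ∑ k with r j ≤ r k, (q k - nextLevel q r k) = q j := by
  rw [sum_decrement_of_upper hq hr hqr]
  · apply le_antisymm
    · rw [Finset.fold_max_le]
      exact ⟨hq j, fun x hx => hqr _ _ (by simpa using hx)⟩
    · rw [Finset.le_fold_max]
      exact Or.inr ⟨j, by simp, le_rfl⟩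
  · intro a b hb hab
    simp only [Finset.mem_filter, Finset.mem_univ, true_and] at hb ⊢
    exact hb.trans hab

theorem sum_decrement_le_one {q : A → ℝ} (hq : ∀ j, 0 ≤ q j) (hq1 : ∀ j, q j ≤ 1) {r : A → K}
    (hr : Function.Injective r) (hqr : ∀ j k, r j ≤ r k → q k ≤ q j) :
    ∑ k, (q k - nextLevel q r k) ≤ 1 := by
  rw [sum_decrement_of_upper hq hr hqr _ (by simp), Finset.fold_max_le]
  exact ⟨zero_le_one, fun x _ => hq1 x⟩

theorem lovasz_eq_sum_gain {w : Finset A → ℝ} (h0 : w ∅ = 0) {q : A → ℝ} (hq : ∀ j, 0 ≤ q j)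
    {r : A → K} (hr : Function.Injective r) (hqr : ∀ j k, r j ≤ r k → q k ≤ q j) :
    lovasz w q r = ∑ j, gain w r j * q j := by
  have h1 : ∀ k, w {j | r j ≤ r k} = ∑ j, if r j ≤ r k then gain w r j else 0 := by
    intro k
    rw [← Finset.sum_filter, sum_gain_of_lower h0 hr]
    intro i j hj hij
    simp only [Finset.mem_filter, Finset.mem_univ, true_and] at hj ⊢
    exact hij.trans hj
  simp only [lovasz, h1, Finset.mul_sum]
  rw [Finset.sum_comm]
  refine Finset.sum_congr rfl fun j _ => ?_
  conv_rhs => rw [← sum_decrement_ge hq hr hqr j]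
  rw [Finset.sum_filter, Finset.mul_sum]
  refine Finset.sum_congr rfl fun k _ => ?_
  split_ifs <;> ring

/-- Weak duality: any weighted family of sets covering each `j` with weight at least `q j` costs
at least the value of the greedy vector at `q`. -/
theorem sum_gain_le_of_cover {w : Finset A → ℝ} (hw : IsSubmodular w) (h0 : w ∅ = 0)
    (hmono : ∀ S T, S ⊆ T → w S ≤ w T) {q : A → ℝ} {r : A → K} (hr : Function.Injective r)
    {κ : Type*} [Fintype κ] (p : κ → ℝ) (hp : ∀ k, 0 ≤ p k) (N : κ → Finset A)
    (hN : ∀ j, q j ≤ ∑ k with j ∈ N k, p k) :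
    ∑ j, gain w r j * q j ≤ ∑ k, p k * w (N k) := by
  have hg : ∀ j, 0 ≤ gain w r j := fun j =>
    sub_nonneg.2 (hmono _ _ fun x hx => by
      simp only [Finset.mem_filter, Finset.mem_univ, true_and] at hx ⊢
      exact hx.le)
  calc ∑ j, gain w r j * q j
      ≤ ∑ j, gain w r j * ∑ k with j ∈ N k, p k :=
        Finset.sum_le_sum fun j _ => mul_le_mul_of_nonneg_left (hN j) (hg j)
    _ = ∑ k, p k * ∑ j ∈ N k, gain w r j := by
        have h1 : ∀ k, ∑ j ∈ N k, gain w r j = ∑ j, if j ∈ N k then gain w r j else 0 := by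
          intro k
          rw [← Finset.sum_filter]
          simp
        simp only [h1, Finset.sum_filter, Finset.mul_sum]
        rw [Finset.sum_comm]
        refine Finset.sum_congr rfl fun j _ => Finset.sum_congr rfl fun k _ => ?_
        split_ifs <;> ring
    _ ≤ ∑ k, p k * w (N k) :=
        Finset.sum_le_sum fun k _ => mul_le_mul_of_nonneg_left (sum_gain_le hw h0 hr _) (hp k)

/-- The greedy value does not depend on how ties of `q` are ordered: each order yields a cover,
so each value is at least the other one by duality. -/
theorem lovasz_eq_sum_gain_of_antitone {K' : Type*} [LinearOrder K'] {w : Finset A → ℝ}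
    (hw : IsSubmodular w) (h0 : w ∅ = 0) (hmono : ∀ S T, S ⊆ T → w S ≤ w T) {q : A → ℝ}
    (hq : ∀ j, 0 ≤ q j) {r : A → K} (hr : Function.Injective r)
    (hqr : ∀ j k, r j ≤ r k → q k ≤ q j) {r' : A → K'} (hr' : Function.Injective r')
    (hqr' : ∀ j k, r' j ≤ r' k → q k ≤ q j) :
    lovasz w q r = ∑ j, gain w r' j * q j := by
  apply le_antisymm
  · rw [lovasz_eq_sum_gain h0 hq hr hqr, ← lovasz_eq_sum_gain h0 hq hr' hqr']
    exact sum_gain_le_of_cover hw h0 hmono hr _ (decrement_nonneg hq hqr') _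
      fun j => by simpa using (sum_decrement_ge hq hr' hqr' j).ge
  · exact sum_gain_le_of_cover hw h0 hmono hr' _ (decrement_nonneg hq hqr) _
      fun j => by simpa using (sum_decrement_ge hq hr hqr j).ge

end Greedy

/-- Truncating a monotone submodular function at a constant keeps it submodular. -/
theorem isSubmodular_min {A : Type*} [DecidableEq A] {v : Finset A → ℝ} (hv : IsSubmodular v)
    (hmono : ∀ S T, S ⊆ T → v S ≤ v T) (x : ℝ) : IsSubmodular fun S => min x (v S) := by
  intro S T hST i
  have h1 := hv S T hST i
  have h2 := hmono _ _ hST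
  have h3 := hmono _ _ (Finset.subset_insert i S)
  have h4 := hmono _ _ (Finset.subset_insert i T)
  simp only
  rcases le_total x (v T) with h | h
  · rw [min_eq_left h, min_eq_left (h.trans h4), sub_self, sub_nonneg]
    exact min_le_min le_rfl h3
  · rw [min_eq_right h, min_eq_right (h2.trans h)]
    rcases le_total x (v (insert i S)) with h' | h'
    · rw [min_eq_left h']
      linarith [min_le_left x (v (insert i T))]
    · rw [min_eq_right h']
      linarith [min_le_right x (v (insert i T))]

/-! ### The cheapest inspection policy for a fixed action and contract -/

section Policy

variable {A : Type*}

/-- A key that sorts the elements by decreasing value of `q` and, among equal values, by `e`. -/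
def key (q : A → ℝ) (e : A → ℕ) (j : A) : ℝᵒᵈ ×ₗ ℕ := toLex (OrderDual.toDual (q j), e j)

theorem key_le_key {q : A → ℝ} {e : A → ℕ} {j k : A} :
    key q e j ≤ key q e k ↔ q k ≤ q j ∧ ¬ (q j ≤ q k ∧ e k < e j) := by
  simp only [key, Prod.Lex.toLex_le_toLex, OrderDual.toDual_lt_toDual, OrderDual.toDual_inj]
  constructor
  · rintro (h | ⟨h, h'⟩)
    · exact ⟨h.le, fun h' => absurd h'.1 (not_le.2 h)⟩
    · exact ⟨h.ge, fun h'' => absurd h' (not_le.2 h''.2)⟩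
  · rintro ⟨h, h'⟩
    rcases h.lt_or_eq with h1 | h1
    · exact Or.inl h1
    · exact Or.inr ⟨h1.symm, not_lt.1 fun h2 => h' ⟨h1.ge, h2⟩⟩

theorem key_injective {e : A → ℕ} (he : Function.Injective e) (q : A → ℝ) :
    Function.Injective (key q e) := by
  intro j k h
  have h1 := (key_le_key.1 h.le).2
  have h2 := (key_le_key.1 h.ge)
  have h3 := (key_le_key.1 h.le).1
  exact he (le_antisymm (not_lt.1 fun h4 => h1 ⟨h2.1, h4⟩) (not_lt.1 fun h4 => h2.2 ⟨h3, h4⟩))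

theorem key_antitone {q : A → ℝ} {e : A → ℕ} (j k : A) (h : key q e j ≤ key q e k) :
    q k ≤ q j := (key_le_key.1 h).1

/-- The least probability with which the inspection has to catch the deviation from `i` to `j`
under the contract `α`. If `α * f j = 0` the quotient is `0`, which is the right value, since then
`j` never pays more than `0`. It also vanishes for `j = i`. -/
noncomputable def Instance.required (I : Instance A) (i : A) (α : ℝ) (j : A) : ℝ :=
  max 0 (((I.f j - I.f i) * α + (I.c i - I.c j)) / (I.f j * α))

/-- The cost of `S`, capped at `v {i}`: inspecting `i` alone already catches every deviation. -/
noncomputable def Instance.cappedCost (I : Instance A) (i : A) (S : Finset A) : ℝ :=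
  min (I.v {i}) (I.v S)

theorem Instance.v_nonneg (I : Instance A) (S : Finset A) : 0 ≤ I.v S :=
  I.v_empty ▸ I.v_mono _ _ (Finset.empty_subset S)

theorem Instance.cappedCost_empty (I : Instance A) (i : A) : I.cappedCost i ∅ = 0 := by
  simp [cappedCost, I.v_empty, I.v_nonneg]

theorem Instance.cappedCost_mono (I : Instance A) (i : A) (S T : Finset A) (h : S ⊆ T) :
    I.cappedCost i S ≤ I.cappedCost i T := min_le_min le_rfl (I.v_mono _ _ h)

theorem Instance.required_nonneg (I : Instance A) (i : A) (α : ℝ) (j : A) :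
    0 ≤ I.required i α j := le_max_left _ _

theorem Instance.required_le_one (I : Instance A) {i : A} {α : ℝ} (hα : 0 ≤ α)
    (hi : I.c i ≤ α * I.f i) (j : A) : I.required i α j ≤ 1 := by
  refine max_le zero_le_one (div_le_one_of_le₀ ?_ (mul_nonneg (I.f_nonneg j) hα))
  nlinarith [I.c_nonneg j]

theorem Instance.required_zero (I : Instance A) (i j : A) : I.required i 0 j = 0 := by
  simp [required]

theorem Instance.cappedCost_submodular [DecidableEq A] {I : Instance A}
    (hv : IsSubmodular I.v) (i : A) : IsSubmodular (I.cappedCost i) := isSubmodular_min hv I.v_mono _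

variable [Fintype A] [DecidableEq A]

/-- The cost of the cheapest inspection policy making the action `i` incentive compatible under
the contract `α`. -/
noncomputable def Instance.minCost (I : Instance A) (e : A → ℕ) (i : A) (α : ℝ) : ℝ :=
  lovasz (I.cappedCost i) (I.required i α) (key (I.required i α) e)

theorem Scheme.caught_eq_sum (σ : Scheme A) (j : A) :
    σ.caught j = ∑ S, σ.p S * if σ.action ∈ S ∨ j ∈ S then 1 else 0 := by
  have h : ∀ S : Finset A,
      (({σ.action, j} : Finset A) ∩ S).Nonempty ↔ σ.action ∈ S ∨ j ∈ S := by
    intro S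
    constructor
    · rintro ⟨x, hx⟩
      simp only [Finset.mem_inter, Finset.mem_insert, Finset.mem_singleton] at hx
      rcases hx with ⟨rfl | rfl, h⟩ <;> tauto
    · rintro (h | h)
      · exact ⟨σ.action, by simpa using h⟩
      · exact ⟨j, by simpa using h⟩
  simp only [caught, Finset.sum_filter, h, mul_ite, mul_one, mul_zero]

theorem Scheme.caught_nonneg (σ : Scheme A) (j : A) : 0 ≤ σ.caught j :=
  Finset.sum_nonneg fun S _ => σ.p_nonneg S

theorem Scheme.caught_le_one (σ : Scheme A) (j : A) : σ.caught j ≤ 1 := by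
  rw [← σ.p_sum]
  exact Finset.sum_le_sum_of_subset_of_nonneg (Finset.subset_univ _) fun S _ _ => σ.p_nonneg S

theorem Instance.IsIC.cost_le {I : Instance A} {τ : Scheme A} (h : I.IsIC τ) :
    I.c τ.action ≤ τ.contract * I.f τ.action := by
  obtain ⟨z, hz⟩ := I.exists_null
  by_cases hzi : z = τ.action
  · rw [← hzi, hz]
    exact mul_nonneg τ.contract_nonneg (I.f_nonneg z)
  · have h1 := h z
    simp only [agentUtility, if_neg hzi, if_true, hz] at h1
    have h2 : 0 ≤ τ.contract * I.f z * (1 - τ.caught z) :=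
      mul_nonneg (mul_nonneg τ.contract_nonneg (I.f_nonneg z))
        (sub_nonneg.2 (τ.caught_le_one z))
    linarith

theorem Instance.IsIC.required_le {I : Instance A} {τ : Scheme A} (h : I.IsIC τ) (j : A) :
    I.required τ.action τ.contract j ≤ τ.caught j := by
  refine max_le (τ.caught_nonneg j) ?_
  rcases (mul_nonneg (I.f_nonneg j) τ.contract_nonneg).eq_or_lt with h0 | h0
  · rw [← h0, div_zero]
    exact τ.caught_nonneg j
  · rw [div_le_iff₀ h0]
    by_cases hj : j = τ.action
    · rw [hj, sub_self, sub_self, zero_mul, add_zero]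
      exact mul_nonneg (τ.caught_nonneg _) (hj ▸ h0.le)
    · have h1 := h j
      simp only [agentUtility, if_neg hj, if_true] at h1
      linarith

theorem Instance.isIC_of_required_le {I : Instance A} {τ : Scheme A}
    (hc : I.c τ.action ≤ τ.contract * I.f τ.action)
    (h : ∀ j, I.required τ.action τ.contract j ≤ τ.caught j) : I.IsIC τ := by
  intro j
  by_cases hj : j = τ.action
  · rw [hj]
  simp only [agentUtility, if_neg hj, if_true]
  rcases (mul_nonneg (I.f_nonneg j) τ.contract_nonneg).eq_or_lt with h0 | h0
  · rw [mul_comm τ.contract, ← h0]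
    linarith [I.c_nonneg j]
  · have h1 := (le_max_right _ _).trans (h j)
    rw [div_le_iff₀ h0] at h1
    linarith

theorem Instance.IsIC.minCost_le {I : Instance A} (hv : IsSubmodular I.v) {e : A → ℕ}
    (he : Function.Injective e) {τ : Scheme A} (h : I.IsIC τ) :
    I.minCost e τ.action τ.contract ≤ ∑ S, τ.p S * I.v S := by
  rw [minCost, lovasz_eq_sum_gain (I.cappedCost_empty _) (I.required_nonneg _ _)
    (key_injective he _) key_antitone]
  refine (sum_gain_le_of_cover (I.cappedCost_submodular hv _) (I.cappedCost_empty _)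
    (I.cappedCost_mono _) (key_injective he _) τ.p τ.p_nonneg
    (fun S => if τ.action ∈ S then Finset.univ else S) fun j => ?_).trans
    (Finset.sum_le_sum fun S _ => mul_le_mul_of_nonneg_left ?_ (τ.p_nonneg S))
  · refine (h.required_le j).trans (le_of_eq ?_)
    rw [Scheme.caught_eq_sum, Finset.sum_filter]
    refine Finset.sum_congr rfl fun S _ => ?_
    by_cases h1 : τ.action ∈ S <;> simp [h1]
  · split_ifs with h1
    · exact (min_le_left _ _).trans (I.v_mono _ _ (Finset.singleton_subset_iff.2 h1))
    · exact min_le_right _ _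

/-- The set inspected in the outcome `o` of the optimal policy: an initial segment of the order
by decreasing required probability, replaced by `{i}` if that is cheaper, or nothing. -/
noncomputable def Instance.outcomeSet (I : Instance A) (e : A → ℕ) (i : A) (α : ℝ) :
    Option A → Finset A
  | none => ∅
  | some k =>
    if I.v {j | key (I.required i α) e j ≤ key (I.required i α) e k} ≤ I.v {i} then
      ({j | key (I.required i α) e j ≤ key (I.required i α) e k} : Finset A)
    else {i}

/-- The probability of the outcome `o` of the optimal policy. -/
noncomputable def Instance.outcomeProb (I : Instance A) (e : A → ℕ) (i : A) (α : ℝ) :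
    Option A → ℝ
  | none => 1 - ∑ k, (I.required i α k - nextLevel (I.required i α) (key (I.required i α) e) k)
  | some k => I.required i α k - nextLevel (I.required i α) (key (I.required i α) e) k

/-- The distribution on sets induced by the outcomes; distinct outcomes may inspect the same
set. -/
noncomputable def Instance.policy (I : Instance A) (e : A → ℕ) (i : A) (α : ℝ)
    (S : Finset A) : ℝ :=
  ∑ o, if I.outcomeSet e i α o = S then I.outcomeProb e i α o else 0

theorem Instance.sum_policy_mul (I : Instance A) (e : A → ℕ) (i : A) (α : ℝ)
    (g : Finset A → ℝ) :
    ∑ S, I.policy e i α S * g S = ∑ o, I.outcomeProb e i α o * g (I.outcomeSet e i α o) := by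
  simp only [policy, Finset.sum_mul]
  rw [Finset.sum_comm]
  refine Finset.sum_congr rfl fun o _ => ?_
  rw [Finset.sum_eq_single (I.outcomeSet e i α o)]
  · simp
  · intro S _ hS
    simp [hS.symm]
  · simp

theorem Instance.outcomeProb_nonneg (I : Instance A) {e : A → ℕ} (he : Function.Injective e)
    {i : A} {α : ℝ} (hα : 0 ≤ α) (hi : I.c i ≤ α * I.f i) (o : Option A) :
    0 ≤ I.outcomeProb e i α o := by
  cases o with
  | none =>
    exact sub_nonneg.2 (sum_decrement_le_one (I.required_nonneg _ _) (I.required_le_one hα hi)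
      (key_injective he _) key_antitone)
  | some k => exact decrement_nonneg (I.required_nonneg _ _) key_antitone k

/-- The optimal policy for the action `i` and the contract `α`, as an inspection scheme. -/
noncomputable def Instance.bestScheme (I : Instance A) (e : A → ℕ) (he : Function.Injective e)
    (i : A) (α : ℝ) (hα : 0 ≤ α) (hα1 : α ≤ 1) (hi : I.c i ≤ α * I.f i) : Scheme A where
  action := i
  contract := α
  p := I.policy e i α
  contract_nonneg := hα
  contract_le_one := hα1
  p_nonneg S := Finset.sum_nonneg fun o _ => by
    split_ifs
    · exact I.outcomeProb_nonneg he hα hi o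
    · exact le_rfl
  p_sum := by
    have h := I.sum_policy_mul e i α fun _ => 1
    simp only [mul_one] at h
    rw [h, Fintype.sum_option]
    simp [outcomeProb]

theorem Instance.support_policy (I : Instance A) (e : A → ℕ) (i : A) (α : ℝ) :
    (Function.support (I.policy e i α)).ncard ≤ Fintype.card A + 1 := by
  have h : Function.support (I.policy e i α) ⊆
      (Finset.univ.image (I.outcomeSet e i α) : Finset (Finset A)) := by
    intro S hS
    obtain ⟨o, _, ho⟩ := Finset.exists_ne_zero_of_sum_ne_zero hS
    have : I.outcomeSet e i α o = S := by
      by_contra h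
      simp [h] at ho
    simp only [Finset.coe_image, Finset.coe_univ, Set.image_univ]
    exact ⟨o, this⟩
  refine (Set.ncard_le_ncard h (Finset.finite_toSet _)).trans ?_
  rw [Set.ncard_coe_finset]
  refine Finset.card_image_le.trans ?_
  simp

variable {I : Instance A} {e : A → ℕ} (he : Function.Injective e) {i : A} {α : ℝ} (hα : 0 ≤ α)
  (hα1 : α ≤ 1) (hi : I.c i ≤ α * I.f i)

theorem Instance.bestScheme_isIC : I.IsIC (I.bestScheme e he i α hα hα1 hi) := by
  refine isIC_of_required_le hi fun j => ?_
  rw [Scheme.caught_eq_sum]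
  change I.required i α j ≤ ∑ S, I.policy e i α S * _
  rw [sum_policy_mul, Fintype.sum_option,
    ← sum_decrement_ge (I.required_nonneg i α) (key_injective he _) key_antitone j,
    Finset.sum_filter]
  refine le_add_of_nonneg_of_le ?_ (Finset.sum_le_sum fun k _ => ?_)
  · exact mul_nonneg (I.outcomeProb_nonneg he hα hi _) (by split_ifs <;> simp)
  · have h0 := I.outcomeProb_nonneg he hα hi (some k)
    split_ifs with h1 h2 h2
    · exact (mul_one _).ge
    · refine absurd ?_ h2
      simp only [outcomeSet]
      split_ifs
      · exact Or.inr (by simpa using h1)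
      · exact Or.inl (Finset.mem_singleton_self i)
    · simpa using h0
    · simp

theorem Instance.bestScheme_utility :
    I.principalUtility (I.bestScheme e he i α hα hα1 hi) i =
      (1 - α) * I.f i - I.minCost e i α := by
  have h : ∑ S, I.policy e i α S * I.v S = I.minCost e i α := by
    rw [sum_policy_mul, Fintype.sum_option, minCost, lovasz]
    simp only [outcomeSet, I.v_empty, mul_zero, zero_add, outcomeProb, cappedCost]
    refine Finset.sum_congr rfl fun k _ => ?_
    congr 1
    split_ifs with h
    · rw [min_eq_right h]
    · rw [min_eq_left (le_of_not_ge h)]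
  simp only [principalUtility, bestScheme, if_true, h]

end Policy

/-! ### Finitely many candidate contracts -/

/-- The function `α ↦ f * α + Q / α` attains its minimum on `[a, b]` at `√(Q / f)`, moved into the
interval. -/
theorem sqrt_clamp_le {f Q a b α : ℝ} (hf : 0 < f) (ha : 0 < a) (h1 : a ≤ α) (h2 : α ≤ b) :
    f * max a (min b √(Q / f)) + Q / max a (min b √(Q / f)) ≤ f * α + Q / α := by
  have hα : 0 < α := ha.trans_le h1
  set β := max a (min b √(Q / f)) with hβ
  have hβ0 : 0 < β := ha.trans_le (le_max_left _ _)
  have hfac : f * α + Q / α - (f * β + Q / β) = f * ((α - β) * (α * β - Q / f)) / (α * β) := by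
    field_simp
    ring
  have key : 0 ≤ (α - β) * (α * β - Q / f) := by
    rcases le_or_gt Q 0 with hQ | hQ
    · have h3 : √(Q / f) = 0 := Real.sqrt_eq_zero'.2 (div_nonpos_of_nonpos_of_nonneg hQ hf.le)
      have h4 : β = a := by
        rw [hβ, h3, max_eq_left]
        exact (min_le_right _ _).trans ha.le
      have h5 : Q / f ≤ 0 := div_nonpos_of_nonpos_of_nonneg hQ hf.le
      exact mul_nonneg (by linarith) (by nlinarith [mul_pos hα hβ0])
    · set s := √(Q / f) with hs
      have hs2 : Q / f = s * s := (Real.mul_self_sqrt (div_pos hQ hf).le).symm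
      have hs0 : 0 ≤ s := Real.sqrt_nonneg _
      rw [hs2]
      rcases le_total s a with h | h
      · have h4 : β = a := by rw [hβ, max_eq_left ((min_le_right _ _).trans h)]
        rw [h4]
        exact mul_nonneg (by linarith) (by nlinarith)
      · rcases le_total s b with h' | h'
        · have h4 : β = s := by rw [hβ, min_eq_right h', max_eq_right h]
          rw [h4]
          nlinarith [mul_nonneg hs0 (mul_self_nonneg (α - s))]
        · have h4 : β = b := by rw [hβ, min_eq_left h', max_eq_right (h1.trans h2)]
          rw [h4]
          exact mul_nonneg_of_nonpos_of_nonpos (by linarith) (by nlinarith)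
  have : 0 ≤ f * ((α - β) * (α * β - Q / f)) / (α * β) := by positivity
  linarith

section Candidates

variable {A : Type*}

/-- The contract at which the required probabilities of `j` and `k` cross: these are affine
functions of `1 / α`, before truncation at `0`. -/
noncomputable def Instance.crossing (I : Instance A) (i j k : A) : ℝ :=
  ((I.c i - I.c k) / I.f k - (I.c i - I.c j) / I.f j) /
    ((I.f j - I.f i) / I.f j - (I.f k - I.f i) / I.f k)

/-- The points that cut the interval `[c i / f i, 1]` of contracts into pieces on which the order
of the required probabilities is constant. A crossing does not depend on the order of the pair, so
the pairs with `e k < e j` are free to stand for the endpoint `1`; the diagonal pairs give the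
other endpoint, since their quotient is `0 / 0 = 0`. -/
noncomputable def Instance.breakpoint (I : Instance A) (e : A → ℕ) (i j k : A) : ℝ :=
  if e k < e j then 1 else max (I.c i / I.f i) (min 1 (I.crossing i j k))

/-- The required probability of `j` before truncation at `0`. -/
noncomputable def Instance.rawRequired (I : Instance A) (i : A) (α : ℝ) (j : A) : ℝ :=
  ((I.f j - I.f i) * α + (I.c i - I.c j)) / (I.f j * α)

variable {I : Instance A} {e : A → ℕ}

theorem Instance.breakpoint_mem {i : A} (hi : I.c i ≤ I.f i) (j k : A) :
    I.breakpoint e i j k ∈ Set.Icc (I.c i / I.f i) 1 := by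
  have h1 : I.c i / I.f i ≤ 1 := div_le_one_of_le₀ hi (I.f_nonneg i)
  unfold breakpoint
  split_ifs
  · exact ⟨h1, le_rfl⟩
  · exact ⟨le_max_left _ _, max_le h1 (min_le_left _ _)⟩

theorem Instance.cost_le_of_mem {i : A} {α : ℝ} (hi : I.c i ≤ I.f i)
    (h : I.c i / I.f i ≤ α) : I.c i ≤ α * I.f i := by
  rcases (I.f_nonneg i).eq_or_lt with h0 | h0
  · rw [← h0] at hi ⊢
    simpa using hi
  · exact (div_le_iff₀ h0).1 h

theorem Instance.breakpoint_self (i j : A) (hi : 0 ≤ I.f i) :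
    I.breakpoint e i j j = I.c i / I.f i := by
  have h : 0 ≤ I.c i / I.f i := div_nonneg (I.c_nonneg i) hi
  simp [breakpoint, crossing, h]

theorem Instance.crossing_comm (i j k : A) : I.crossing i j k = I.crossing i k j := by
  unfold crossing
  rw [← neg_sub ((I.c i - I.c j) / I.f j), ← neg_sub ((I.f k - I.f i) / I.f k), neg_div_neg_eq]

theorem Instance.exists_breakpoint_eq {i j k : A} (h1 : I.c i / I.f i ≤ I.crossing i j k)
    (h2 : I.crossing i j k ≤ 1) : ∃ j' k', I.breakpoint e i j' k' = I.crossing i j k := by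
  rcases le_total (e j) (e k) with h | h
  · refine ⟨j, k, ?_⟩
    rw [breakpoint, if_neg (not_lt.2 h), min_eq_right h2, max_eq_right h1]
  · refine ⟨k, j, ?_⟩
    rw [breakpoint, if_neg (not_lt.2 h), crossing_comm, min_eq_right h2, max_eq_right h1]

theorem Instance.rawRequired_eq {i : A} {α : ℝ} (hα : 0 < α) (j : A) :
    I.rawRequired i α j = (I.f j - I.f i) / I.f j + (I.c i - I.c j) / I.f j * (1 / α) := by
  unfold rawRequired
  rcases (I.f_nonneg j).eq_or_lt with h | h
  · simp [← h]
  · field_simp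

/-- The order of two required probabilities does not change between neighbouring breakpoints. -/
theorem Instance.rawRequired_le {i : A} {a b α β : ℝ} (ha : 0 < a) (hca : I.c i / I.f i ≤ a)
    (hb : b ≤ 1) (hab : ∀ j k, I.breakpoint e i j k ∉ Set.Ioo a b) (hα : α ∈ Set.Ioo a b)
    (hβ : β ∈ Set.Icc a b) {j k : A} (h : I.rawRequired i α k ≤ I.rawRequired i α j) :
    I.rawRequired i β k ≤ I.rawRequired i β j := by
  have hα0 : 0 < α := ha.trans hα.1
  have hβ0 : 0 < β := ha.trans_le hβ.1
  by_contra hcon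
  rw [not_le] at hcon
  rw [rawRequired_eq hα0, rawRequired_eq hα0] at h
  rw [rawRequired_eq hβ0, rawRequired_eq hβ0] at hcon
  have hcr : I.crossing i j k = ((I.c i - I.c k) / I.f k - (I.c i - I.c j) / I.f j) /
    ((I.f j - I.f i) / I.f j - (I.f k - I.f i) / I.f k) := rfl
  set uj := (I.f j - I.f i) / I.f j
  set uk := (I.f k - I.f i) / I.f k
  set tj := (I.c i - I.c j) / I.f j
  set tk := (I.c i - I.c k) / I.f k
  have h1 : 0 ≤ (uj - uk) * α + (tj - tk) := by
    have : (uj - uk) * α + (tj - tk) = α * ((uj + tj * (1 / α)) - (uk + tk * (1 / α))) := by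
      field_simp
      ring
    rw [this]
    exact mul_nonneg hα0.le (sub_nonneg.2 h)
  have h2 : (uj - uk) * β + (tj - tk) < 0 := by
    have : (uj - uk) * β + (tj - tk) = β * ((uj + tj * (1 / β)) - (uk + tk * (1 / β))) := by
      field_simp
      ring
    rw [this]
    exact mul_neg_of_pos_of_neg hβ0 (sub_neg.2 hcon)
  have hmem : I.crossing i j k ∈ Set.Ioo a b := by
    rw [hcr]
    rcases lt_trichotomy (uj - uk) 0 with hu | hu | hu
    · exact ⟨hα.1.trans_le ((le_div_iff_of_neg hu).2 (by linarith)),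
        ((div_lt_iff_of_neg hu).2 (by linarith)).trans_le hβ.2⟩
    · rw [hu] at h1 h2
      linarith
    · exact ⟨hβ.1.trans_lt ((lt_div_iff₀ hu).2 (by linarith)),
        ((div_le_iff₀ hu).2 (by linarith)).trans_lt hα.2⟩
  obtain ⟨j', k', h'⟩ := I.exists_breakpoint_eq (e := e) (hca.trans hmem.1.le)
    (hmem.2.le.trans hb)
  exact hab j' k' (h' ▸ hmem)

variable [Fintype A]

/-- On a piece between neighbouring breakpoints `a` and `b` the inspection cost is `P + Q / α`;
this is the contract in the piece maximizing the utility `(1 - α) * f i - P - Q / α`. It is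
`√(Q / f i)`, moved into the piece; a negative `Q` gives the left endpoint. -/
noncomputable def Instance.candidate (I : Instance A) (e : A → ℕ) (i : A) (a b : ℝ) : ℝ :=
  max (min a b) (min (max a b)
    (√(((I.minCost e i b - I.minCost e i a) / (1 / b - 1 / a)) / I.f i)))

/-- The principal's utility if she implements the action `i` by the contract `α` and inspects
optimally. -/
noncomputable def Instance.value (I : Instance A) (e : A → ℕ) (i : A) (α : ℝ) : ℝ :=
  (1 - α) * I.f i - I.minCost e i α

theorem Instance.candidate_mem {i : A} {lo hi a b : ℝ} (ha : a ∈ Set.Icc lo hi)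
    (hb : b ∈ Set.Icc lo hi) : I.candidate e i a b ∈ Set.Icc lo hi :=
  ⟨(le_min ha.1 hb.1).trans (le_max_left _ _),
    max_le ((min_le_left _ _).trans ha.2) ((min_le_left _ _).trans (max_le ha.2 hb.2))⟩

theorem Instance.candidate_self (i : A) (a : ℝ) : I.candidate e i a a = a := by
  simp [candidate]

theorem Instance.minCost_zero (i : A) : I.minCost e i 0 = 0 := by
  have h : I.required i 0 = fun _ => 0 := funext fun j => I.required_zero i j
  have h' : ∀ k, nextLevel (fun _ : A => (0 : ℝ)) (key (fun _ : A => (0 : ℝ)) e) k = 0 := by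
    intro k
    refine le_antisymm (nextLevel_le_iff.2 ⟨le_rfl, fun _ _ => le_rfl⟩) ?_
    exact (nextLevel_le_iff.1 le_rfl).1
  simp [minCost, lovasz, h, h']

/-- Every candidate is a contract under which `i` is worth its cost. -/
theorem Instance.candidate_bounds {i : A} (hi : I.c i ≤ I.f i) (j₁ k₁ j₂ k₂ : A) {α : ℝ}
    (hα : α = I.candidate e i (I.breakpoint e i j₁ k₁) (I.breakpoint e i j₂ k₂)) :
    0 ≤ α ∧ α ≤ 1 ∧ I.c i ≤ α * I.f i := by
  have h := candidate_mem (I := I) (e := e) (i := i) (I.breakpoint_mem (e := e) hi j₁ k₁)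
    (I.breakpoint_mem (e := e) hi j₂ k₂)
  rw [← hα] at h
  exact ⟨(div_nonneg (I.c_nonneg i) (I.f_nonneg i)).trans h.1, h.2, cost_le_of_mem hi h.1⟩

variable [DecidableEq A]

/-- Between neighbouring breakpoints the inspection cost is affine in `1 / α`. -/
theorem Instance.minCost_eq_on_piece (hv : IsSubmodular I.v) (he : Function.Injective e)
    {i : A} {a b α : ℝ} (ha : 0 < a) (hca : I.c i / I.f i ≤ a)
    (hb : b ≤ 1) (hab : ∀ j k, I.breakpoint e i j k ∉ Set.Ioo a b) (hα : α ∈ Set.Ioo a b) :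
    ∃ P Q : ℝ, ∀ β ∈ Set.Icc a b, I.minCost e i β = P + Q * (1 / β) := by
  set r := key (I.required i α) e
  have hraw : ∀ β j, I.required i β j = max 0 (I.rawRequired i β j) := fun _ _ => rfl
  have hii : ∀ β, I.rawRequired i β i = 0 := by
    intro β
    simp [rawRequired]
  -- A negative required probability stays so in the whole piece: compare with that of `i`.
  have hform : ∀ j, ∃ u t : ℝ, ∀ β ∈ Set.Icc a b, I.required i β j = u + t * (1 / β) := by
    intro j
    rcases le_total (I.rawRequired i α i) (I.rawRequired i α j) with h | h
    · refine ⟨(I.f j - I.f i) / I.f j, (I.c i - I.c j) / I.f j, fun β hβ => ?_⟩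
      rw [← rawRequired_eq (ha.trans_le hβ.1), hraw, max_eq_right]
      exact hii β ▸ rawRequired_le ha hca hb hab hα hβ h
    · refine ⟨0, 0, fun β hβ => ?_⟩
      rw [hraw, max_eq_left (hii β ▸ rawRequired_le ha hca hb hab hα hβ h)]
      ring
  have hanti : ∀ β ∈ Set.Icc a b, ∀ j k, r j ≤ r k → I.required i β k ≤ I.required i β j := by
    intro β hβ j k hjk
    have h1 : I.required i α k ≤ I.required i α j := key_antitone j k hjk
    rw [hraw, hraw] at h1 ⊢
    rcases le_total (I.rawRequired i α k) (I.rawRequired i α j) with h | h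
    · exact max_le_max le_rfl (rawRequired_le ha hca hb hab hα hβ h)
    · have h2 : I.rawRequired i α k ≤ I.rawRequired i α i ∨
          I.rawRequired i α k ≤ I.rawRequired i α j := by
        rw [hii]
        rcases le_total (I.rawRequired i α k) 0 with h3 | h3
        · exact Or.inl h3
        · rw [max_eq_right h3] at h1
          rcases le_max_iff.1 h1 with h4 | h4
          · exact Or.inl h4
          · exact Or.inr h4
      rcases h2 with h2 | h2
      · rw [max_eq_left (hii β ▸ rawRequired_le ha hca hb hab hα hβ h2)]
        exact le_max_left _ _
      · exact max_le_max le_rfl (rawRequired_le ha hca hb hab hα hβ h2)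
  choose u t hut using hform
  refine ⟨∑ j, gain (I.cappedCost i) r j * u j, ∑ j, gain (I.cappedCost i) r j * t j,
    fun β hβ => ?_⟩
  rw [minCost, lovasz_eq_sum_gain_of_antitone (cappedCost_submodular hv i)
    (I.cappedCost_empty i) (I.cappedCost_mono i) (I.required_nonneg i β) (key_injective he _)
    key_antitone (key_injective he (I.required i α)) (hanti β hβ), Finset.sum_mul,
    ← Finset.sum_add_distrib]
  refine Finset.sum_congr rfl fun j _ => ?_
  rw [hut j β hβ]
  ring

/-- The contract of any incentive-compatible scheme can be replaced by a candidate. -/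
theorem Instance.IsIC.exists_candidate (hv : IsSubmodular I.v) (he : Function.Injective e)
    {τ : Scheme A} (h : I.IsIC τ) : I.c τ.action ≤ I.f τ.action ∧
      ∃ j₁ k₁ j₂ k₂, I.principalUtility τ τ.action ≤ I.value e τ.action
        (I.candidate e τ.action (I.breakpoint e τ.action j₁ k₁)
          (I.breakpoint e τ.action j₂ k₂)) := by
  set i := τ.action with hi_def
  set α := τ.contract with hα_def
  have hc : I.c i ≤ α * I.f i := h.cost_le
  have hα1 : α ≤ 1 := τ.contract_le_one
  have hcf : I.c i ≤ I.f i := hc.trans (mul_le_of_le_one_left (I.f_nonneg i) hα1)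
  refine ⟨hcf, ?_⟩
  have hu : I.principalUtility τ i ≤ I.value e i α := by
    rw [principalUtility, if_pos rfl, value]
    linarith [h.minCost_le hv he]
  have hself := I.breakpoint_self (e := e) i i (I.f_nonneg i)
  rcases (I.c_nonneg i).eq_or_lt with h0 | h0
  · -- A costless action is implemented by the contract `0` without inspections.
    refine ⟨i, i, i, i, hu.trans ?_⟩
    rw [candidate_self, hself, ← h0, zero_div, value, value, minCost_zero]
    have h1 : 0 ≤ I.minCost e i α := by
      have : ∀ k, 0 ≤ I.required i α k -
          nextLevel (I.required i α) (key (I.required i α) e) k :=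
        decrement_nonneg (I.required_nonneg i α) key_antitone
      exact Finset.sum_nonneg fun k _ => mul_nonneg (this k)
        (le_min (I.v_nonneg _) (I.v_nonneg _))
    nlinarith [mul_nonneg τ.contract_nonneg (I.f_nonneg i)]
  have hf : 0 < I.f i := h0.trans_le hcf
  have hlo : I.c i / I.f i ≤ α := (div_le_iff₀ hf).2 hc
  have hlo0 : 0 < I.c i / I.f i := div_pos h0 hf
  -- The endpoint `1` is a breakpoint, as there are two actions: `i` and the costless one.
  have hone : ∃ j k, I.breakpoint e i j k = 1 := by
    obtain ⟨z, hz⟩ := I.exists_null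
    have hzi : e z ≠ e i := fun hzi => by
      rw [← he hzi, hz] at h0
      exact lt_irrefl _ h0
    rcases hzi.lt_or_gt with h1 | h1
    · exact ⟨i, z, if_pos h1⟩
    · exact ⟨z, i, if_pos h1⟩
  set B : Finset ℝ := Finset.univ.image fun x : A × A => I.breakpoint e i x.1 x.2 with hB
  have hmemB : ∀ j k, I.breakpoint e i j k ∈ B := fun j k =>
    Finset.mem_image.2 ⟨(j, k), Finset.mem_univ _, rfl⟩
  obtain ⟨a, haB, ha⟩ : ∃ a ∈ B.filter (· ≤ α), ∀ x ∈ B.filter (· ≤ α), x ≤ a :=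
    Finset.exists_max_image _ id
      ⟨_, Finset.mem_filter.2 ⟨hmemB i i, hself.trans_le hlo⟩⟩
  obtain ⟨b, hbB, hb⟩ : ∃ b ∈ B.filter (α ≤ ·), ∀ x ∈ B.filter (α ≤ ·), b ≤ x := by
    obtain ⟨j, k, hjk⟩ := hone
    exact Finset.exists_min_image _ id
      ⟨_, Finset.mem_filter.2 ⟨hmemB j k, hα1.trans_eq hjk.symm⟩⟩
  obtain ⟨haB, haα⟩ := Finset.mem_filter.1 haB
  obtain ⟨hbB, hαb⟩ := Finset.mem_filter.1 hbB
  obtain ⟨⟨j₁, k₁⟩, -, h1⟩ := Finset.mem_image.1 haB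
  obtain ⟨⟨j₂, k₂⟩, -, h2⟩ := Finset.mem_image.1 hbB
  simp only at h1 h2
  have hcont : ∀ j k, I.breakpoint e i j k ∉ Set.Ioo a b := by
    intro j k hjk
    rcases le_total (I.breakpoint e i j k) α with h3 | h3
    · exact absurd hjk.1 (not_lt.2 (ha _ (Finset.mem_filter.2 ⟨hmemB j k, h3⟩)))
    · exact absurd hjk.2 (not_lt.2 (hb _ (Finset.mem_filter.2 ⟨hmemB j k, h3⟩)))
  rcases haα.eq_or_lt with h3 | haα
  · exact ⟨j₁, k₁, j₁, k₁, by rwa [candidate_self, h1, h3]⟩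
  rcases hαb.eq_or_lt with h3 | hαb
  · exact ⟨j₂, k₂, j₂, k₂, by rwa [candidate_self, h2, ← h3]⟩
  refine ⟨j₁, k₁, j₂, k₂, hu.trans ?_⟩
  rw [h1, h2]
  have hca : I.c i / I.f i ≤ a := h1 ▸ (breakpoint_mem hcf j₁ k₁).1
  have ha0 : 0 < a := hlo0.trans_le hca
  have hb1 : b ≤ 1 := h2 ▸ (breakpoint_mem hcf j₂ k₂).2
  have hlt : a < b := haα.trans hαb
  obtain ⟨P, Q, hPQ⟩ := minCost_eq_on_piece hv he ha0 hca hb1 hcont ⟨haα, hαb⟩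
  have hcand : I.candidate e i a b = max a (min b √(Q / I.f i)) := by
    have h4 : (I.minCost e i b - I.minCost e i a) / (1 / b - 1 / a) = Q := by
      rw [hPQ a ⟨le_rfl, hlt.le⟩, hPQ b ⟨hlt.le, le_rfl⟩, div_eq_iff]
      · ring
      · exact (sub_neg.2 (one_div_lt_one_div_of_lt ha0 hlt)).ne
    rw [candidate, h4, min_eq_left hlt.le, max_eq_right hlt.le]
  rw [hcand, value, value, hPQ α ⟨haα.le, hαb.le⟩,
    hPQ _ ⟨le_max_left _ _, max_le hlt.le (min_le_left _ _)⟩]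
  have h5 := sqrt_clamp_le (Q := Q) hf ha0 haα.le hαb.le
  simp only [mul_one_div]
  linarith

/-- It suffices to compare the candidates with each other. -/
theorem Instance.bestScheme_isOptimalIC (hv : IsSubmodular I.v) (he : Function.Injective e)
    {i : A} {α : ℝ} (hα : 0 ≤ α) (hα1 : α ≤ 1) (hi : I.c i ≤ α * I.f i)
    (hmax : ∀ i' j₁ k₁ j₂ k₂, I.c i' ≤ I.f i' → I.value e i' (I.candidate e i'
      (I.breakpoint e i' j₁ k₁) (I.breakpoint e i' j₂ k₂)) ≤ I.value e i α) :
    I.IsOptimalIC (I.bestScheme e he i α hα hα1 hi) := by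
  refine ⟨bestScheme_isIC he hα hα1 hi, fun τ hτ => ?_⟩
  obtain ⟨hc, j₁, k₁, j₂, k₂, h⟩ := hτ.exists_candidate hv he
  exact (h.trans (hmax _ _ _ _ _ hc)).trans_eq (bestScheme_utility he hα hα1 hi).symm

theorem Instance.exists_isOptimalIC (hv : IsSubmodular I.v) :
    ∃ σ : Scheme A, I.IsOptimalIC σ ∧
      (Function.support σ.p).ncard ≤ Fintype.card A + 1 := by
  obtain ⟨z, hz⟩ := I.exists_null
  set e : A → ℕ := fun a => (Fintype.equivFin A a).val
  have he : Function.Injective e := Fin.val_injective.comp (Fintype.equivFin A).injective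
  obtain ⟨⟨i, j₁, k₁, j₂, k₂⟩, hmem, hmax⟩ := Finset.exists_max_image
    (Finset.univ.filter fun x : A × A × A × A × A => I.c x.1 ≤ I.f x.1)
    (fun x => I.value e x.1 (I.candidate e x.1
      (I.breakpoint e x.1 x.2.1 x.2.2.1) (I.breakpoint e x.1 x.2.2.2.1 x.2.2.2.2)))
    ⟨(z, z, z, z, z), by simp [hz, I.f_nonneg]⟩
  obtain ⟨h1, h2, h3⟩ := I.candidate_bounds (e := e) (by simpa using hmem) j₁ k₁ j₂ k₂ rfl
  refine ⟨_, bestScheme_isOptimalIC hv he h1 h2 h3 fun i' j₁' k₁' j₂' k₂' h' => ?_,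
    I.support_policy e i _⟩
  exact hmax (i', j₁', k₁', j₂', k₂') (by simpa using h')

end Candidates

/-! ### Structured programs -/

/-- Programs whose only loops run a counter through `0, …, n - 1`. They always halt, within a time
polynomial in `n` that can be read off the text. `forN k C` uses entry `0` of the integer array
`k` as its counter. -/
inductive Prog where
  | skip
  | setN (a : ℕ) (i e : NExp)
  | setR (a : ℕ) (i : NExp) (e : RExp)
  | query (a : ℕ) (o : NExp) (r : ℕ) (i : NExp)
  | seq (C D : Prog)
  | ite (b : BExp) (C D : Prog)
  | forN (k : ℕ) (C : Prog)

/-- Entry `0` of an integer array, used as a scalar variable. -/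
abbrev NExp.var (a : ℕ) : NExp := .get a (.const 0)

/-- Entry `0` of a real array, used as a scalar variable. -/
abbrev RExp.var (a : ℕ) : RExp := .get a (.const 0)

namespace Prog

/-- Translation to the machine language; the number `n` is read from integer array `0`. -/
def code : Prog → Cmd
  | skip => .skip
  | setN a i e => .setN a i e
  | setR a i e => .setR a i e
  | query a o r i => .query a o r i
  | seq C D => .seq C.code D.code
  | ite b C D => .ite b C.code D.code
  | forN k C => .seq (.setN k (.const 0) (.const 0))
      (.whileDo (.not (.nle (.var 0) (.var k)))
        (.seq C.code (.setN k (.const 0) (.add (.var k) (.const 1)))))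

open scoped Classical in
/-- The function on stores computed by a program. -/
noncomputable def run {n : ℕ} (v : Finset (Fin n) → ℝ) : Prog → Store → Store
  | skip, s => s
  | setN a i e, s => s.writeN a (i.eval s) (e.eval s)
  | setR a i e, s => s.writeR a (i.eval s) (e.eval s)
  | query a o r i, s => s.writeR r (i.eval s) (v (s.readSet n a (o.eval s)))
  | seq C D, s => D.run v (C.run v s)
  | ite b C D, s => if b.eval s then C.run v s else D.run v s
  | forN k C, s =>
      Nat.rec (s.writeN k 0 0) (fun j st => (C.run v st).writeN k 0 (j + 1)) n

/-- The integer arrays a program may write to. -/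
def natWrites : Prog → List ℕ
  | skip => []
  | setN a _ _ => [a]
  | setR _ _ _ => []
  | query _ _ _ _ => []
  | seq C D => C.natWrites ++ D.natWrites
  | ite _ C D => C.natWrites ++ D.natWrites
  | forN k C => k :: C.natWrites

/-- The real arrays a program may write to. -/
def realWrites : Prog → List ℕ
  | skip => []
  | setN _ _ _ => []
  | setR a _ _ => [a]
  | query _ _ r _ => [r]
  | seq C D => C.realWrites ++ D.realWrites
  | ite _ C D => C.realWrites ++ D.realWrites
  | forN _ C => C.realWrites

/-- No loop body writes to the counter of its loop. -/
def CountersSafe : Prog → Prop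
  | seq C D => C.CountersSafe ∧ D.CountersSafe
  | ite _ C D => C.CountersSafe ∧ D.CountersSafe
  | forN k C => k ∉ C.natWrites ∧ C.CountersSafe
  | _ => True

/-- A bound for the running time, as a polynomial in `n`. -/
noncomputable def time : Prog → Polynomial ℕ
  | skip => 1
  | setN _ i e => .C (i.cost + e.cost + 1)
  | setR _ i e => .C (i.cost + e.cost + 1)
  | query _ o _ i => .C (o.cost + i.cost + 1) + .X
  | seq C D => C.time + D.time
  | ite b C D => .C b.cost + C.time + D.time
  | forN _ C => 3 + (.X + 1) * 6 + .X * (C.time + 6)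

variable {n : ℕ} (v : Finset (Fin n) → ℝ)

section Run

variable (s : Store)

@[simp]
theorem run_skip : skip.run v s = s := rfl

@[simp]
theorem run_setN (a : ℕ) (i e : NExp) :
    (setN a i e).run v s = s.writeN a (i.eval s) (e.eval s) := rfl

@[simp]
theorem run_setR (a : ℕ) (i : NExp) (e : RExp) :
    (setR a i e).run v s = s.writeR a (i.eval s) (e.eval s) := rfl

@[simp]
theorem run_query (a : ℕ) (o : NExp) (r : ℕ) (i : NExp) :
    (query a o r i).run v s = s.writeR r (i.eval s) (v (s.readSet n a (o.eval s))) := rfl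

@[simp]
theorem run_seq (C D : Prog) : (seq C D).run v s = D.run v (C.run v s) := by rw [run]

theorem run_ite_of_pos {b : BExp} (h : b.eval s) (C D : Prog) :
    (ite b C D).run v s = C.run v s := if_pos h

theorem run_ite_of_neg {b : BExp} (h : ¬ b.eval s) (C D : Prog) :
    (ite b C D).run v s = D.run v s := if_neg h

end Run

theorem run_nat (P : Prog) (s : Store) {a : ℕ} (h : a ∉ P.natWrites) :
    (P.run v s).nat a = s.nat a := by
  induction P generalizing s with
  | skip => rfl
  | setN b i e =>
    have : a ≠ b := by simpa [natWrites] using h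
    simp [run, Store.writeN, this]
  | setR => rfl
  | query => rfl
  | seq C D hC hD =>
    simp only [natWrites, List.mem_append, not_or] at h
    rw [run, hD _ h.2, hC _ h.1]
  | ite b C D hC hD =>
    simp only [natWrites, List.mem_append, not_or] at h
    rw [run]
    split_ifs
    · exact hC _ h.1
    · exact hD _ h.2
  | forN k C hC =>
    simp only [natWrites, List.mem_cons, not_or] at h
    have key : ∀ m : ℕ, (Nat.rec (s.writeN k 0 0)
        (fun j st => (C.run v st).writeN k 0 (j + 1)) m : Store).nat a = s.nat a := by
      intro m
      induction m with
      | zero => simp [Store.writeN, h.1]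
      | succ m ih =>
        rw [← ih]
        refine Eq.trans ?_ (hC _ h.2)
        simp [Store.writeN, h.1]
    exact key n

theorem run_real (P : Prog) (s : Store) {a : ℕ} (h : a ∉ P.realWrites) :
    (P.run v s).real a = s.real a := by
  induction P generalizing s with
  | skip => rfl
  | setN => rfl
  | setR b i e =>
    have : a ≠ b := by simpa [realWrites] using h
    simp [run, Store.writeR, this]
  | query b o r i =>
    have : a ≠ r := by simpa [realWrites] using h
    simp [run, Store.writeR, this]
  | seq C D hC hD =>
    simp only [realWrites, List.mem_append, not_or] at h
    rw [run, hD _ h.2, hC _ h.1]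
  | ite b C D hC hD =>
    simp only [realWrites, List.mem_append, not_or] at h
    rw [run]
    split_ifs
    · exact hC _ h.1
    · exact hD _ h.2
  | forN k C hC =>
    simp only [realWrites] at h
    have key : ∀ m : ℕ, (Nat.rec (s.writeN k 0 0)
        (fun j st => (C.run v st).writeN k 0 (j + 1)) m : Store).real a = s.real a := by
      intro m
      induction m with
      | zero => rfl
      | succ m ih =>
        rw [← ih]
        exact hC _ h
    exact key n

/-- Induction over the passes of a loop. Arrays that the body does not write to keep their
contents. -/
theorem forN_induction (Inv : ℕ → Store → Prop) (k : ℕ) (C : Prog) (s : Store)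
    (zero : Inv 0 (s.writeN k 0 0))
    (step : ∀ j < n, ∀ st : Store, st.nat k 0 = j →
      (∀ a ∉ (forN k C).natWrites, st.nat a = s.nat a) →
      (∀ a ∉ C.realWrites, st.real a = s.real a) →
      Inv j st → Inv (j + 1) ((C.run v st).writeN k 0 (j + 1))) :
    Inv n ((forN k C).run v s) := by
  have key : ∀ m ≤ n, ∀ st : Store, st = (Nat.rec (s.writeN k 0 0)
      (fun j st => (C.run v st).writeN k 0 (j + 1)) m : Store) →
      st.nat k 0 = m ∧ (∀ a ∉ (forN k C).natWrites, st.nat a = s.nat a) ∧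
      (∀ a ∉ C.realWrites, st.real a = s.real a) ∧ Inv m st := by
    intro m hm
    induction m with
    | zero =>
      rintro _ rfl
      refine ⟨by simp [Store.writeN], fun a ha => ?_, fun a _ => rfl, zero⟩
      simp only [natWrites, List.mem_cons, not_or] at ha
      simp [Store.writeN, ha.1]
    | succ m ih =>
      rintro _ rfl
      obtain ⟨h1, h2, h3, h4⟩ := ih (by omega) _ rfl
      refine ⟨by simp [Store.writeN], fun a ha => ?_, fun a ha => ?_,
        step m (by omega) _ h1 h2 h3 h4⟩
      · rw [← h2 a ha]
        simp only [natWrites, List.mem_cons, not_or] at ha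
        refine Eq.trans ?_ (run_nat v C _ ha.2)
        simp [Store.writeN, ha.1]
      · rw [← h3 a ha]
        exact run_real v C _ ha
  exact (key n le_rfl _ rfl).2.2.2

/-- The translated program halts within the bound `time` and computes `run`. -/
theorem exec_code (P : Prog) (hP : P.CountersSafe) (h0 : 0 ∉ P.natWrites) (s : Store)
    (hs : s.nat 0 0 = n) :
    ∃ t ≤ P.time.eval n, Exec v P.code s t (P.run v s) := by
  induction P generalizing s with
  | skip => exact ⟨1, by simp [time], .skip s⟩
  | setN a i e => exact ⟨_, by simp [time], .setN a i e s⟩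
  | setR a i e => exact ⟨_, by simp [time], .setR a i e s⟩
  | query a o r i => exact ⟨_, by simp [time], .query a o r i s⟩
  | seq C D hC hD =>
    simp only [natWrites, List.mem_append, not_or] at h0
    obtain ⟨t₁, ht₁, h₁⟩ := hC hP.1 h0.1 s hs
    obtain ⟨t₂, ht₂, h₂⟩ := hD hP.2 h0.2 (C.run v s) (by rw [run_nat v C s h0.1, hs])
    exact ⟨t₁ + t₂, by simpa [time] using add_le_add ht₁ ht₂, .seq h₁ h₂⟩
  | ite b C D hC hD =>
    simp only [natWrites, List.mem_append, not_or] at h0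
    by_cases hb : b.eval s
    · obtain ⟨t, ht, h⟩ := hC hP.1 h0.1 s hs
      refine ⟨b.cost + t, by simp [time]; omega, ?_⟩
      rw [run, if_pos hb]
      exact .ite_true hb h
    · obtain ⟨t, ht, h⟩ := hD hP.2 h0.2 s hs
      refine ⟨b.cost + t, by simp [time]; omega, ?_⟩
      rw [run, if_neg hb]
      exact .ite_false hb h
  | forN k C hC =>
    have hk := hP.1
    simp only [natWrites, List.mem_cons, not_or] at h0
    set S : ℕ → Store := fun m => Nat.rec (s.writeN k 0 0)
      (fun j st => (C.run v st).writeN k 0 (j + 1)) m with hS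
    have hSk : ∀ m, (S m).nat k 0 = m := by
      intro m
      cases m <;> simp [hS, Store.writeN]
    have hS0 : ∀ m, (S m).nat 0 0 = n := by
      intro m
      induction m with
      | zero => simp [hS, Store.writeN, h0.1, hs]
      | succ m ih =>
        rw [← ih]
        change ((C.run v (S m)).writeN k 0 (m + 1)).nat 0 0 = _
        rw [← run_nat v C (S m) h0.2]
        simp [Store.writeN, h0.1]
    have loop : ∀ d m, m + d = n →
        ∃ t ≤ (d + 1) * 6 + d * (C.time.eval n + 6),
          Exec v (.whileDo (.not (.nle (.var 0) (.var k)))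
            (.seq C.code (.setN k (.const 0) (.add (.var k) (.const 1))))) (S m) t (S n) := by
      intro d
      induction d with
      | zero =>
        rintro m rfl
        refine ⟨_, ?_, .while_false ?_⟩
        · simp [BExp.cost, NExp.cost]
        · simp [BExp.eval, NExp.eval, hS0, hSk]
      | succ d ih =>
        intro m hm
        obtain ⟨t₁, ht₁, h₁⟩ := hC hP.2 h0.2 (S m) (hS0 m)
        obtain ⟨t₂, ht₂, h₂⟩ := ih (m + 1) (by omega)
        have hinc : Exec v (.setN k (.const 0) (.add (.var k) (.const 1)))
            (C.run v (S m)) 6 (S (m + 1)) := by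
          have h := Exec.setN (v := v) k (.const 0) (.add (.var k) (.const 1)) (C.run v (S m))
          simp only [NExp.eval, run_nat v C (S m) hk, hSk] at h
          exact h
        refine ⟨_, ?_, .while_true ?_ (.seq h₁ hinc) h₂⟩
        · simp only [BExp.cost, NExp.cost]
          nlinarith
        · simp [BExp.eval, NExp.eval, hS0, hSk]
          omega
    obtain ⟨t, ht, h⟩ := loop n 0 (by omega)
    refine ⟨3 + t, ?_, .seq (.setN k (.const 0) (.const 0) s) h⟩
    simp [time]
    omega

end Prog

/-! ### The program -/

section Program

/-- Maximum of two reals, through `|x| = √(x * x)`. -/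
def RExp.max (x y : RExp) : RExp :=
  .div (.add (.add x y) (.sqrt (.mul (.sub x y) (.sub x y)))) (.const 2)

/-- Minimum of two reals, through `|x| = √(x * x)`. -/
def RExp.min (x y : RExp) : RExp :=
  .div (.sub (.add x y) (.sqrt (.mul (.sub x y) (.sub x y)))) (.const 2)

@[simp]
theorem RExp.eval_max (s : Store) (x y : RExp) :
    (RExp.max x y).eval s = Max.max (x.eval s) (y.eval s) := by
  simp only [RExp.max, RExp.eval, Real.sqrt_mul_self_eq_abs]
  rcases le_total (x.eval s) (y.eval s) with h | h
  · rw [abs_of_nonpos (sub_nonpos.2 h), max_eq_right h]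
    push_cast
    ring
  · rw [abs_of_nonneg (sub_nonneg.2 h), max_eq_left h]
    push_cast
    ring

@[simp]
theorem RExp.eval_min (s : Store) (x y : RExp) :
    (RExp.min x y).eval s = Min.min (x.eval s) (y.eval s) := by
  simp only [RExp.min, RExp.eval, Real.sqrt_mul_self_eq_abs]
  rcases le_total (x.eval s) (y.eval s) with h | h
  · rw [abs_of_nonpos (sub_nonpos.2 h), min_eq_left h]
    push_cast
    ring
  · rw [abs_of_nonneg (sub_nonneg.2 h), min_eq_right h]
    push_cast
    ring

open Prog

attribute [local simp] run_ite_of_pos run_ite_of_neg NExp.eval RExp.eval BExp.eval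
  Store.writeN Store.writeR Prog.natWrites Prog.realWrites

/-- Fills real array `4` with the required probabilities for the action in integer variable `3`
and the contract in real variable `5`. -/
def requiredProg : Prog :=
  .forN 9 (.setR 4 (.var 9) (.max (.const 0)
    (.div (.add (.mul (.sub (.get 1 (.var 9)) (.get 1 (.var 3))) (.var 5))
      (.sub (.get 0 (.var 3)) (.get 0 (.var 9)))) (.mul (.get 1 (.var 9)) (.var 5)))))

/-- The indicator of `j = i`, for `i` in integer variable `3` and `j` in integer variable `9`,
by truncated subtraction. -/
def indicator : NExp :=
  .sub (.const 1) (.add (.sub (.var 9) (.var 3)) (.sub (.var 3) (.var 9)))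

/-- Writes `v {i}` to real variable `7`, for `i` in integer variable `3`. -/
def singletonProg : Prog :=
  .seq (.forN 9 (.setN 10 (.var 9) indicator)) (.query 10 (.const 0) 7 (.const 0))

/-- The test whether `j` does not come after `k` in the order of the values in real array `4`,
for `k` in integer variable `8` and `j` in integer variable `9`. -/
def beforeTest : BExp :=
  .and (.rle (.get 4 (.var 8)) (.get 4 (.var 9)))
    (.not (.and (.rle (.get 4 (.var 9)) (.get 4 (.var 8))) (.not (.nle (.var 9) (.var 8)))))

/-- For `k` in integer variable `8`: the initial segment ending at `k` goes to integer array `10`,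
its value to real variable `8`, and the level following that of `k` to real variable `6`. -/
def segmentProg : Prog :=
  .seq (.setR 6 (.const 0) (.const 0)) <|
  .seq (.forN 9 (.ite beforeTest (.setN 10 (.var 9) (.const 1))
    (.seq (.setN 10 (.var 9) (.const 0))
      (.setR 6 (.const 0) (.max (.var 6) (.get 4 (.var 9))))))) <|
  .query 10 (.const 0) 8 (.const 0)

/-- Writes the inspection cost for the action in integer variable `3` and the contract in real
variable `5` to real variable `9`. -/
def costProg : Prog :=
  .seq requiredProg <| .seq singletonProg <| .seq (.setR 9 (.const 0) (.const 0)) <|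
  .forN 8 <| .seq segmentProg <|
    .setR 9 (.const 0) (.add (.var 9)
      (.mul (.sub (.get 4 (.var 8)) (.var 6)) (.min (.var 7) (.var 8))))

/-- Writes the breakpoint of the pair in the integer variables `a` and `b` to real variable `d`. -/
def breakpointProg (a b d : ℕ) : Prog :=
  .ite (.not (.nle (.var a) (.var b))) (.setR d (.const 0) (.const 1))
    (.setR d (.const 0) (.max (.div (.get 0 (.var 3)) (.get 1 (.var 3))) (.min (.const 1)
      (.div
        (.sub (.div (.sub (.get 0 (.var 3)) (.get 0 (.var b))) (.get 1 (.var b)))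
          (.div (.sub (.get 0 (.var 3)) (.get 0 (.var a))) (.get 1 (.var a))))
        (.sub (.div (.sub (.get 1 (.var a)) (.get 1 (.var 3))) (.get 1 (.var a)))
          (.div (.sub (.get 1 (.var b)) (.get 1 (.var 3))) (.get 1 (.var b))))))))

/-- Evaluates one candidate, and stores its utility, action and contract in real variable `15`,
integer variable `12` and real variable `16` if it is at least as good as the best one so far. -/
def candidateProg : Prog :=
  .seq (breakpointProg 4 5 10) <| .seq (breakpointProg 6 7 11) <|
  .seq (.setR 5 (.const 0) (.var 10)) <| .seq costProg <| .seq (.setR 12 (.const 0) (.var 9)) <|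
  .seq (.setR 5 (.const 0) (.var 11)) <| .seq costProg <| .seq (.setR 13 (.const 0) (.var 9)) <|
  .seq (.setR 5 (.const 0) (.max (.min (.var 10) (.var 11)) (.min (.max (.var 10) (.var 11))
    (.sqrt (.div (.div (.sub (.var 13) (.var 12))
      (.sub (.div (.const 1) (.var 11)) (.div (.const 1) (.var 10)))) (.get 1 (.var 3))))))) <|
  .seq costProg <|
  .seq (.setR 14 (.const 0) (.sub (.mul (.sub (.const 1) (.var 5)) (.get 1 (.var 3))) (.var 9))) <|
  .ite (.rle (.var 15) (.var 14))
    (.seq (.setR 15 (.const 0) (.var 14)) <| .seq (.setN 12 (.const 0) (.var 3)) <|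
      .setR 16 (.const 0) (.var 5)) .skip

/-- Runs through all candidates; the utility `-1` stands for no candidate so far. -/
def searchProg : Prog :=
  .seq (.setR 15 (.const 0) (.const (-1))) <|
  .forN 3 <| .ite (.rle (.get 0 (.var 3)) (.get 1 (.var 3)))
    (.forN 4 <| .forN 5 <| .forN 6 <| .forN 7 candidateProg) .skip

/-- Writes the indicator of the set inspected in the outcome of integer variable `8` to integer
array `2`, starting from the index in integer variable `11`. -/
def writeSetProg : Prog :=
  .forN 9 <| .ite (.rle (.var 8) (.var 7))
    (.setN 2 (.add (.var 11) (.var 9)) (.get 10 (.var 9)))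
    (.setN 2 (.add (.var 11) (.var 9)) indicator)

/-- Writes the optimal policy for the best candidate. -/
def outputProg : Prog :=
  .seq (.setN 3 (.const 0) (.var 12)) <| .seq (.setR 5 (.const 0) (.var 16)) <|
  .seq requiredProg <| .seq singletonProg <|
  .seq (.setN 11 (.const 0) (.const 0)) <| .seq (.setR 17 (.const 0) (.const 0)) <|
  .seq (.forN 8 <| .seq segmentProg <|
    .seq (.setR 3 (.var 8) (.sub (.get 4 (.var 8)) (.var 6))) <|
    .seq (.setR 17 (.const 0) (.add (.var 17) (.get 3 (.var 8)))) <|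
    .seq writeSetProg <| .setN 11 (.const 0) (.add (.var 11) (.var 0))) <|
  .seq (.setR 3 (.var 0) (.sub (.const 1) (.var 17))) <|
  .seq (.setR 2 (.const 0) (.var 5)) <|
  .seq (.setN 1 (.const 0) (.var 3)) <| .setN 1 (.const 1) (.add (.var 0) (.const 1))

/-! ### Correctness of the program -/

variable {n : ℕ} (v : Finset (Fin n) → ℝ)

@[local simp]
theorem natWrites_requiredProg : requiredProg.natWrites = [9] := rfl

@[local simp]
theorem realWrites_requiredProg : requiredProg.realWrites = [4] := rfl

@[local simp]
theorem natWrites_singletonProg : singletonProg.natWrites = [9, 10] := rfl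

@[local simp]
theorem realWrites_singletonProg : singletonProg.realWrites = [7] := rfl

@[local simp]
theorem natWrites_segmentProg : segmentProg.natWrites = [9, 10, 10] := rfl

@[local simp]
theorem realWrites_segmentProg : segmentProg.realWrites = [6, 6, 8] := rfl

@[local simp]
theorem natWrites_costProg : costProg.natWrites = [9, 9, 10, 8, 9, 10, 10] := rfl

@[local simp]
theorem realWrites_costProg : costProg.realWrites = [4, 7, 9, 6, 6, 8, 9] := rfl

@[local simp]
theorem natWrites_writeSetProg : writeSetProg.natWrites = [9, 2, 2] := rfl

@[local simp]
theorem realWrites_writeSetProg : writeSetProg.realWrites = [] := rfl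

attribute [local simp] Prog.run_nat Prog.run_real

theorem requiredProg_spec {I : Instance (Fin n)} {s : Store} {i : Fin n} {α : ℝ}
    (hc : ∀ j : Fin n, s.real 0 j = I.c j) (hf : ∀ j : Fin n, s.real 1 j = I.f j)
    (hi : s.nat 3 0 = i) (hα : s.real 5 0 = α) (j : Fin n) :
    (requiredProg.run v s).real 4 j = I.required i α j := by
  suffices h : ∀ j : Fin n, j.val < n → (requiredProg.run v s).real 4 j = I.required i α j from
    h j j.2
  unfold requiredProg
  refine forN_induction v (fun m st => ∀ j : Fin n, j.val < m →
    st.real 4 j = I.required i α j) 9 _ s (by simp) fun m hm st hk hN hR hinv j hj => ?_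
  have h0 := hR 0 (by simp)
  have h1 := hR 1 (by simp)
  have h5 := hR 5 (by simp)
  have h3 := hN 3 (by simp)
  by_cases hjm : j.val = m
  · subst hjm
    simp [hk, h0, h1, h5, h3, hi, hα, hc, hf, Instance.required]
  · simpa [hk, hjm] using hinv j (by omega)

theorem indicator_ne_zero {s : Store} : indicator.eval s ≠ 0 ↔ s.nat 9 0 = s.nat 3 0 := by
  simp only [indicator, NExp.eval]
  omega

theorem singletonProg_spec {s : Store} {i : Fin n} (hi : s.nat 3 0 = i) :
    (singletonProg.run v s).real 7 0 = v {i} := by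
  have h : ∀ j : ℕ, j < n → ((Prog.run v (.forN 9 (.setN 10 (.var 9) indicator)) s).nat 10 j ≠ 0 ↔
      j = i) := by
    refine forN_induction v (fun m st => ∀ j : ℕ, j < m → (st.nat 10 j ≠ 0 ↔ j = i)) 9 _ s
      (by simp) fun m hm st hk hN hR hinv j hj => ?_
    have h3 := hN 3 (by simp)
    by_cases hjm : j = m
    · subst hjm
      have := indicator_ne_zero (s := st)
      rw [hk, h3, hi] at this
      simpa [hk] using this
    · simpa [hk, hjm] using hinv j (by omega)
  simp only [singletonProg, run_seq, run_query, Store.writeR, NExp.eval, and_self, if_true]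
  congr 1
  ext j
  simp only [Store.readSet, Finset.mem_filter, Finset.mem_univ, true_and, zero_add,
    Finset.mem_singleton, h j j.2, Fin.ext_iff]

theorem beforeTest_eval {s : Store} {q : Fin n → ℝ} (hq : ∀ j : Fin n, s.real 4 j = q j)
    {j k : Fin n} (hk : s.nat 8 0 = k) (hj : s.nat 9 0 = j) :
    beforeTest.eval s ↔ key q Fin.val j ≤ key q Fin.val k := by
  simp [beforeTest, hk, hj, hq, key_le_key]

theorem segmentProg_spec {s : Store} {q : Fin n → ℝ} (hq : ∀ j : Fin n, s.real 4 j = q j)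
    {k : Fin n} (hk : s.nat 8 0 = k) :
    (∀ j : Fin n, (segmentProg.run v s).nat 10 j ≠ 0 ↔ key q Fin.val j ≤ key q Fin.val k) ∧
      (segmentProg.run v s).real 6 0 = nextLevel q (key q Fin.val) k ∧
      (segmentProg.run v s).real 8 0 = v {j | key q Fin.val j ≤ key q Fin.val k} := by
  set s' := Prog.run v (.setR 6 (.const 0) (.const 0)) s
  have h : ∀ s₁ : Store, s₁ = Prog.run v (.forN 9 (.ite beforeTest (.setN 10 (.var 9) (.const 1))
      (.seq (.setN 10 (.var 9) (.const 0))
        (.setR 6 (.const 0) (.max (.var 6) (.get 4 (.var 9))))))) s' →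
      (∀ j : Fin n, j.val < n → (s₁.nat 10 j ≠ 0 ↔ key q Fin.val j ≤ key q Fin.val k)) ∧
      (∀ x : ℝ, s₁.real 6 0 ≤ x ↔
        0 ≤ x ∧ ∀ j : Fin n, j.val < n → key q Fin.val k < key q Fin.val j → q j ≤ x) := by
    rintro _ rfl
    refine forN_induction v (fun m st =>
      (∀ j : Fin n, j.val < m → (st.nat 10 j ≠ 0 ↔ key q Fin.val j ≤ key q Fin.val k)) ∧
      (∀ x : ℝ, st.real 6 0 ≤ x ↔
        0 ≤ x ∧ ∀ j : Fin n, j.val < m → key q Fin.val k < key q Fin.val j → q j ≤ x)) 9 _ s'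
      (by simp [s']) fun m hm st hk9 hN hR hinv => ?_
    have h8 := hN 8 (by simp)
    have h4 := hR 4 (by simp)
    have htest := beforeTest_eval (s := st) (q := q) (j := ⟨m, hm⟩) (k := k)
      (fun j => by simp [h4, s', hq]) (by simp [h8, s', hk]) hk9
    obtain ⟨hi1, hi2⟩ := hinv
    have hsplit : ∀ (p : Fin n → Prop), (∀ j : Fin n, j.val < m + 1 → p j) ↔
        p ⟨m, hm⟩ ∧ ∀ j : Fin n, j.val < m → p j := by
      intro p
      constructor
      · exact fun h => ⟨h _ (by simp), fun j hj => h j (by omega)⟩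
      · rintro ⟨h, h'⟩ j hj
        by_cases hjm : j.val = m
        · have : j = ⟨m, hm⟩ := Fin.ext hjm
          exact this ▸ h
        · exact h' j (by omega)
    rw [hsplit]
    simp only [hsplit]
    have hold : ∀ j : Fin n, j.val < m → j.val ≠ m := fun j hj => hj.ne
    by_cases ht : key q Fin.val (⟨m, hm⟩ : Fin n) ≤ key q Fin.val k
    · have ht' := htest.2 ht
      refine ⟨⟨by simp [ht', hk9, ht], fun j hj => ?_⟩, fun x => ?_⟩
      · simpa [ht', hk9, hold j hj] using hi1 j hj
      · simpa [ht', hk9, ht, not_lt.2 ht] using hi2 x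
    · have ht' : ¬ beforeTest.eval st := fun h => ht (htest.1 h)
      refine ⟨⟨by simp [ht', hk9, ht], fun j hj => ?_⟩, fun x => ?_⟩
      · simpa [ht', hk9, hold j hj] using hi1 j hj
      · have hqm : st.real 4 m = q ⟨m, hm⟩ := by simp [h4, s', ← hq]
        have hqx : q ⟨m, hm⟩ ≤ x ↔ (key q Fin.val k < key q Fin.val ⟨m, hm⟩ → q ⟨m, hm⟩ ≤ x) := by
          simp [lt_of_not_ge ht]
        rw [← hqx, and_left_comm, ← hi2]
        simp [ht', hk9, hqm, and_comm]
  obtain ⟨h1, h2⟩ := h _ rfl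
  have h1' : ∀ j : Fin n, _ := fun j => h1 j j.2
  refine ⟨h1', ?_, ?_⟩
  · refine eq_of_forall_ge_iff fun x => ?_
    rw [nextLevel_le_iff]
    refine Iff.trans ?_ ((h2 x).trans ?_)
    · simp [segmentProg, s']
    · simp
  · simp only [segmentProg, run_seq, run_query, Store.writeR, NExp.eval, and_self, if_true]
    congr 1
    ext j
    simp only [Store.readSet, Finset.mem_filter, Finset.mem_univ, true_and, zero_add]
    exact h1' j

theorem sum_val_lt_succ (g : Fin n → ℝ) {m : ℕ} (hm : m < n) :
    ∑ k : Fin n with k.val < m + 1, g k = (∑ k : Fin n with k.val < m, g k) + g ⟨m, hm⟩ := by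
  have h : ({k : Fin n | k.val < m + 1} : Finset (Fin n)) =
      insert ⟨m, hm⟩ ({k : Fin n | k.val < m} : Finset (Fin n)) := by
    ext k
    simp only [Finset.mem_insert, Finset.mem_filter, Finset.mem_univ, true_and, Fin.ext_iff]
    omega
  rw [h, Finset.sum_insert (by simp), add_comm]

theorem costProg_spec {I : Instance (Fin n)} {s : Store} {i : Fin n} {α : ℝ}
    (hc : ∀ j : Fin n, s.real 0 j = I.c j) (hf : ∀ j : Fin n, s.real 1 j = I.f j)
    (hi : s.nat 3 0 = i) (hα : s.real 5 0 = α) :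
    (costProg.run I.v s).real 9 0 = I.minCost Fin.val i α := by
  set q := I.required i α
  set s₁ := Prog.run I.v (.setR 9 (.const 0) (.const 0))
    (singletonProg.run I.v (requiredProg.run I.v s))
  have hq : ∀ j : Fin n, s₁.real 4 j = q j := fun j => by
    simpa [s₁] using requiredProg_spec I.v hc hf hi hα j
  have h7 : s₁.real 7 0 = I.v {i} := by
    simpa [s₁] using singletonProg_spec I.v (s := requiredProg.run I.v s) (by simpa using hi)
  have h : (Prog.run I.v (.forN 8 <| .seq segmentProg <|
      .setR 9 (.const 0) (.add (.var 9)
        (.mul (.sub (.get 4 (.var 8)) (.var 6)) (.min (.var 7) (.var 8))))) s₁).real 9 0 =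
      ∑ k : Fin n with k.val < n, (q k - nextLevel q (key q Fin.val) k) *
        I.cappedCost i {j | key q Fin.val j ≤ key q Fin.val k} := by
    refine forN_induction I.v (fun m st => st.real 9 0 =
      ∑ k : Fin n with k.val < m, (q k - nextLevel q (key q Fin.val) k) *
        I.cappedCost i {j | key q Fin.val j ≤ key q Fin.val k}) 8 _ s₁ (by simp [s₁])
      fun m hm st hk hN hR hinv => ?_
    have h4 := hR 4 (by simp)
    have h7' := hR 7 (by simp)
    obtain ⟨-, h6, h8⟩ := segmentProg_spec I.v (s := st) (q := q) (k := ⟨m, hm⟩)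
      (fun j => by rw [h4, hq]) hk
    have hqm : st.real 4 m = q ⟨m, hm⟩ := by rw [h4, ← hq]
    rw [sum_val_lt_succ _ hm, ← hinv]
    simp [hk, h6, h8, hqm, h7', h7, Instance.cappedCost]
  have huniv : (Finset.univ.filter fun k : Fin n => k.val < n) = Finset.univ := by simp
  rw [huniv] at h
  exact h

theorem breakpointProg_spec {I : Instance (Fin n)} {s : Store} {i j k : Fin n} {a b d : ℕ}
    (hc : ∀ j : Fin n, s.real 0 j = I.c j) (hf : ∀ j : Fin n, s.real 1 j = I.f j)
    (hi : s.nat 3 0 = i) (hj : s.nat a 0 = j) (hk : s.nat b 0 = k) :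
    ((breakpointProg a b d).run v s).real d 0 = I.breakpoint Fin.val i j k := by
  by_cases h : k.val < j.val
  · have hb : (BExp.not (.nle (.var a) (.var b))).eval s := by simpa [hj, hk] using h
    simp only [breakpointProg, run_ite_of_pos v s hb, Instance.breakpoint, if_pos h]
    simp
  · have hb : ¬ (BExp.not (.nle (.var a) (.var b))).eval s := by simpa [hj, hk] using h
    simp only [breakpointProg, run_ite_of_neg v s hb, Instance.breakpoint, if_neg h]
    simp [hj, hk, hi, hc, hf, Instance.crossing]

@[local simp]
theorem natWrites_breakpointProg (a b d : ℕ) : (breakpointProg a b d).natWrites = [] := rfl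

@[local simp]
theorem realWrites_breakpointProg (a b d : ℕ) : (breakpointProg a b d).realWrites = [d, d] := rfl

/-- The candidate of the action `i` and two pairs. -/
noncomputable def Instance.pairCandidate (I : Instance (Fin n)) (i j₁ k₁ j₂ k₂ : Fin n) : ℝ :=
  I.candidate Fin.val i (I.breakpoint Fin.val i j₁ k₁) (I.breakpoint Fin.val i j₂ k₂)

theorem candidateProg_spec {I : Instance (Fin n)} {s : Store} {i j₁ k₁ j₂ k₂ : Fin n}
    (hc : ∀ j : Fin n, s.real 0 j = I.c j) (hf : ∀ j : Fin n, s.real 1 j = I.f j)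
    (hi : s.nat 3 0 = i) (hj₁ : s.nat 4 0 = j₁) (hk₁ : s.nat 5 0 = k₁) (hj₂ : s.nat 6 0 = j₂)
    (hk₂ : s.nat 7 0 = k₂) {α x : ℝ} (hα : α = I.pairCandidate i j₁ k₁ j₂ k₂)
    (hx : x = I.value Fin.val i α) :
    (s.real 15 0 ≤ x → (candidateProg.run I.v s).real 15 0 = x ∧
      (candidateProg.run I.v s).real 16 0 = α ∧ (candidateProg.run I.v s).nat 12 0 = i) ∧
    (¬ s.real 15 0 ≤ x → (candidateProg.run I.v s).real 15 0 = s.real 15 0 ∧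
      (candidateProg.run I.v s).real 16 0 = s.real 16 0 ∧
      (candidateProg.run I.v s).nat 12 0 = s.nat 12 0) := by
  set a := I.breakpoint Fin.val i j₁ k₁
  set b := I.breakpoint Fin.val i j₂ k₂
  set s₁ := (breakpointProg 6 7 11).run I.v ((breakpointProg 4 5 10).run I.v s) with hs₁
  have ha : s₁.real 10 0 = a := by
    simpa [s₁] using breakpointProg_spec I.v (d := 10) hc hf hi hj₁ hk₁
  have hb : s₁.real 11 0 = b := by
    refine breakpointProg_spec I.v (d := 11) ?_ ?_ ?_ ?_ ?_ <;> simpa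
  have hN₁ : s₁.nat = s.nat := by
    funext x
    simp [s₁]
  have hR₁ : ∀ r, r ≠ 10 → r ≠ 11 → s₁.real r = s.real r := fun r h h' => by simp [s₁, h, h']
  set s₂ := (Prog.seq (.setR 5 (.const 0) (.var 10)) (.seq costProg
    (.setR 12 (.const 0) (.var 9)))).run I.v s₁ with hs₂
  have h12 : s₂.real 12 0 = I.minCost Fin.val i a := by
    simp only [s₂, run_seq, run_setR, Store.writeR, NExp.eval, RExp.eval, and_self, if_true]
    refine costProg_spec ?_ ?_ ?_ ?_ <;> simpa [hN₁, hR₁]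
  have hN₂ : ∀ r < 8, s₂.nat r = s.nat r := by
    intro r hr
    interval_cases r <;> simp [s₂, hN₁]
  have hN₂' : s₂.nat 12 = s.nat 12 := by simp [s₂, hN₁]
  have hR₂ : ∀ r, r < 2 ∨ 14 ≤ r → s₂.real r = s.real r := by
    intro r hr
    have : ∀ m, 2 ≤ m → m < 14 → r ≠ m := by omega
    simp [s₂, hR₁, this]
  have ha₂ : s₂.real 10 0 = a := by simpa [s₂] using ha
  have hb₂ : s₂.real 11 0 = b := by simpa [s₂] using hb
  set s₃ := (Prog.seq (.setR 5 (.const 0) (.var 11)) (.seq costProg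
    (.setR 13 (.const 0) (.var 9)))).run I.v s₂ with hs₃
  have h13 : s₃.real 13 0 = I.minCost Fin.val i b := by
    simp only [s₃, run_seq, run_setR, Store.writeR, NExp.eval, RExp.eval, and_self, if_true]
    refine costProg_spec ?_ ?_ ?_ ?_ <;> simpa [hN₂, hR₂]
  have hN₃ : ∀ r < 8, s₃.nat r = s.nat r := by
    intro r hr
    rw [← hN₂ r hr]
    interval_cases r <;> simp [s₃]
  have hN₃' : s₃.nat 12 = s.nat 12 := by simp [s₃, hN₂']
  have hR₃ : ∀ r, r < 2 ∨ 14 ≤ r → s₃.real r = s.real r := by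
    intro r hr
    have : ∀ m, 2 ≤ m → m < 14 → r ≠ m := by omega
    simp [s₃, hR₂ r hr, this]
  have ha₃ : s₃.real 10 0 = a := by simpa [s₃] using ha₂
  have hb₃ : s₃.real 11 0 = b := by simpa [s₃] using hb₂
  have h12₃ : s₃.real 12 0 = I.minCost Fin.val i a := by simpa [s₃] using h12
  set s₄ := Prog.run I.v (.setR 5 (.const 0) (.max (.min (.var 10) (.var 11))
    (.min (.max (.var 10) (.var 11)) (.sqrt (.div (.div (.sub (.var 13) (.var 12))
      (.sub (.div (.const 1) (.var 11)) (.div (.const 1) (.var 10)))) (.get 1 (.var 3))))))) s₃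
    with hs₄
  have h5 : s₄.real 5 0 = α := by
    simp [s₄, hα, Instance.pairCandidate, Instance.candidate, ha₃, hb₃, h12₃, h13, hN₃, hR₃, hi,
      hf, a, b]
  have h9 : (costProg.run I.v s₄).real 9 0 = I.minCost Fin.val i α := by
    refine costProg_spec ?_ ?_ ?_ h5 <;> simpa [s₄, hN₃, hR₃]
  set s₅ := Prog.run I.v (.setR 14 (.const 0)
    (.sub (.mul (.sub (.const 1) (.var 5)) (.get 1 (.var 3))) (.var 9)))
    (costProg.run I.v s₄) with hs₅
  have h14 : s₅.real 14 0 = x := by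
    have h1 : s₄.real 1 = s.real 1 := by simp [s₄, hR₃]
    have h3 : s₄.nat 3 = s.nat 3 := by simp [s₄, hN₃]
    simp [s₅, h5, h9, hx, Instance.value, h1, h3, hi, hf]
  have h15 : s₅.real 15 = s.real 15 := by simp [s₅, s₄, hR₃]
  have h16 : s₅.real 16 = s.real 16 := by simp [s₅, s₄, hR₃]
  have h3 : s₅.nat 3 = s.nat 3 := by simp [s₅, s₄, hN₃]
  have hn12 : s₅.nat 12 = s.nat 12 := by simp [s₅, s₄, hN₃']
  have h5' : s₅.real 5 = s₄.real 5 := by simp [s₅]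
  have hrun : candidateProg.run I.v s = Prog.run I.v (.ite (.rle (.var 15) (.var 14))
    (.seq (.setR 15 (.const 0) (.var 14)) <| .seq (.setN 12 (.const 0) (.var 3)) <|
      .setR 16 (.const 0) (.var 5)) .skip) s₅ := by
    simp only [candidateProg, run_seq, hs₁, hs₂, hs₃, hs₄, hs₅]
  rw [hrun]
  constructor
  · intro hle
    have ht : (BExp.rle (.var 15) (.var 14)).eval s₅ := by simpa [h15, h14] using hle
    rw [run_ite_of_pos _ _ ht]
    simp [h14, h3, hi, h5', h5]
  · intro hle
    have ht : ¬ (BExp.rle (.var 15) (.var 14)).eval s₅ := by simpa [h15, h14] using hle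
    rw [run_ite_of_neg _ _ ht]
    simp [h15, h16, hn12]

/-- The best candidate recorded in the store, if any, is described correctly; `-1` stands for
none. -/
def Attains (I : Instance (Fin n)) (s : Store) : Prop :=
  s.real 15 0 = -1 ∨ ∃ i j₁ k₁ j₂ k₂ : Fin n, I.c i ≤ I.f i ∧ s.nat 12 0 = i ∧
    s.real 16 0 = I.pairCandidate i j₁ k₁ j₂ k₂ ∧
    s.real 15 0 = I.value Fin.val i (I.pairCandidate i j₁ k₁ j₂ k₂)

/-- Passing from `s` to `s'`, the recorded utility does not decrease and becomes at least every
number in `D`. -/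
def Improves (I : Instance (Fin n)) (D : Set ℝ) (s s' : Store) : Prop :=
  (Attains I s → Attains I s') ∧ s.real 15 0 ≤ s'.real 15 0 ∧ ∀ x ∈ D, x ≤ s'.real 15 0

theorem Improves.forN {I : Instance (Fin n)} {k : ℕ} (hk : k ≠ 12) {C : Prog} {s : Store}
    (D : Fin n → Set ℝ)
    (h : ∀ j : Fin n, ∀ st : Store, st.nat k 0 = j →
      (∀ a ∉ (forN k C).natWrites, st.nat a = s.nat a) →
      (∀ a ∉ C.realWrites, st.real a = s.real a) → Improves I (D j) st (C.run I.v st)) :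
    Improves I {x | ∃ j, x ∈ D j} s ((forN k C).run I.v s) := by
  have hw : ∀ (D : Set ℝ) (s s' : Store) (m : ℕ), Improves I D s s' →
      Improves I D s (s'.writeN k 0 m) := by
    intro D s s' m h
    simpa [Improves, Attains, hk.symm] using h
  have key : Improves I {x | ∃ j : Fin n, j.val < n ∧ x ∈ D j} s ((Prog.forN k C).run I.v s) := by
    refine forN_induction I.v (fun m st => Improves I {x | ∃ j : Fin n, j.val < m ∧ x ∈ D j} s st)
      k C s (hw _ _ _ _ ⟨id, le_rfl, by simp⟩) fun m hm st hst hN hR hinv => hw _ _ _ _ ?_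
    obtain ⟨h1, h2, h3⟩ := h ⟨m, hm⟩ st hst hN hR
    refine ⟨h1 ∘ hinv.1, hinv.2.1.trans h2, ?_⟩
    rintro x ⟨j, hj, hx⟩
    by_cases hjm : j.val = m
    · have : j = ⟨m, hm⟩ := Fin.ext hjm
      exact h3 x (this ▸ hx)
    · exact (hinv.2.2 x ⟨j, by omega, hx⟩).trans h2
  exact ⟨key.1, key.2.1, fun x ⟨j, hx⟩ => key.2.2 x ⟨j, j.2, hx⟩⟩

theorem candidateProg_improves {I : Instance (Fin n)} {s : Store} {i j₁ k₁ j₂ k₂ : Fin n}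
    (hif : I.c i ≤ I.f i)
    (hc : ∀ j : Fin n, s.real 0 j = I.c j) (hf : ∀ j : Fin n, s.real 1 j = I.f j)
    (hi : s.nat 3 0 = i) (hj₁ : s.nat 4 0 = j₁) (hk₁ : s.nat 5 0 = k₁) (hj₂ : s.nat 6 0 = j₂)
    (hk₂ : s.nat 7 0 = k₂) :
    Improves I {I.value Fin.val i (I.pairCandidate i j₁ k₁ j₂ k₂)} s
      (candidateProg.run I.v s) := by
  obtain ⟨h1, h2⟩ := candidateProg_spec hc hf hi hj₁ hk₁ hj₂ hk₂ rfl rfl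
  by_cases h : s.real 15 0 ≤ I.value Fin.val i (I.pairCandidate i j₁ k₁ j₂ k₂)
  · obtain ⟨h3, h4, h5⟩ := h1 h
    exact ⟨fun _ => Or.inr ⟨i, j₁, k₁, j₂, k₂, hif, h5, h4, h3⟩, h3 ▸ h, fun x hx => h3 ▸ hx.le⟩
  · obtain ⟨h3, h4, h5⟩ := h2 h
    refine ⟨?_, h3.ge, fun x hx => ?_⟩
    · unfold Attains
      rw [h3, h4, h5]
      exact id
    · rw [h3]
      exact hx.le.trans (not_le.1 h).le

theorem searchProg_spec {I : Instance (Fin n)} {s : Store}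
    (hc : ∀ j : Fin n, s.real 0 j = I.c j) (hf : ∀ j : Fin n, s.real 1 j = I.f j) :
    ∃ i j₁ k₁ j₂ k₂ : Fin n, I.c i ≤ I.f i ∧ (searchProg.run I.v s).nat 12 0 = i ∧
      (searchProg.run I.v s).real 16 0 = I.pairCandidate i j₁ k₁ j₂ k₂ ∧
      ∀ i' j₁' k₁' j₂' k₂' : Fin n, I.c i' ≤ I.f i' →
        I.value Fin.val i' (I.pairCandidate i' j₁' k₁' j₂' k₂') ≤
          I.value Fin.val i (I.pairCandidate i j₁ k₁ j₂ k₂) := by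
  set s₀ := Prog.run I.v (.setR 15 (.const 0) (.const (-1))) s with hs₀
  have hloop : Improves I {x | ∃ i, x ∈ {x | I.c i ≤ I.f i ∧
      x ∈ {x | ∃ j₁, x ∈ {x | ∃ k₁, x ∈ {x | ∃ j₂, x ∈ {x | ∃ k₂, x ∈
        ({I.value Fin.val i (I.pairCandidate i j₁ k₁ j₂ k₂)} : Set ℝ)}}}}}}
      s₀ (searchProg.run I.v s) := by
    refine Improves.forN (by decide) _ fun i st₁ hi hN₁ hR₁ => ?_
    have h0 : ∀ j : Fin n, st₁.real 0 j = I.c j := fun j => by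
      rw [hR₁ 0 (by decide), ← hc j]
      simp [s₀]
    have h1 : ∀ j : Fin n, st₁.real 1 j = I.f j := fun j => by
      rw [hR₁ 1 (by decide), ← hf j]
      simp [s₀]
    by_cases hif : I.c i ≤ I.f i
    · rw [run_ite_of_pos _ _ (by simpa [hi, h0, h1] using hif)]
      have key : Improves I {x | ∃ j₁, x ∈ {x | ∃ k₁, x ∈ {x | ∃ j₂, x ∈ {x | ∃ k₂, x ∈
          ({I.value Fin.val i (I.pairCandidate i j₁ k₁ j₂ k₂)} : Set ℝ)}}}} st₁
          ((Prog.forN 4 <| .forN 5 <| .forN 6 <| .forN 7 candidateProg).run I.v st₁) := by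
        refine Improves.forN (by decide) _ fun j₁ st₂ hj₁ hN₂ hR₂ => ?_
        refine Improves.forN (by decide) _ fun k₁ st₃ hk₁ hN₃ hR₃ => ?_
        refine Improves.forN (by decide) _ fun j₂ st₄ hj₂ hN₄ hR₄ => ?_
        refine Improves.forN (by decide) _ fun k₂ st₅ hk₂ hN₅ hR₅ => ?_
        refine candidateProg_improves hif ?_ ?_ ?_ ?_ ?_ ?_ hk₂
        · intro j
          rw [hR₅ 0 (by decide), hR₄ 0 (by decide), hR₃ 0 (by decide), hR₂ 0 (by decide), h0]
        · intro j
          rw [hR₅ 1 (by decide), hR₄ 1 (by decide), hR₃ 1 (by decide), hR₂ 1 (by decide), h1]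
        · rw [hN₅ 3 (by decide), hN₄ 3 (by decide), hN₃ 3 (by decide), hN₂ 3 (by decide), hi]
        · rw [hN₅ 4 (by decide), hN₄ 4 (by decide), hN₃ 4 (by decide), hj₁]
        · rw [hN₅ 5 (by decide), hN₄ 5 (by decide), hk₁]
        · rw [hN₅ 6 (by decide), hj₂]
      exact ⟨key.1, key.2.1, fun x hx => key.2.2 x hx.2⟩
    · rw [run_ite_of_neg _ _ (by simpa [hi, h0, h1] using hif)]
      exact ⟨id, le_rfl, fun x hx => absurd hx.1 hif⟩
  obtain ⟨hA, -, hD⟩ := hloop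
  have hD' : ∀ i' j₁' k₁' j₂' k₂' : Fin n, I.c i' ≤ I.f i' →
      I.value Fin.val i' (I.pairCandidate i' j₁' k₁' j₂' k₂') ≤
        (searchProg.run I.v s).real 15 0 := fun i' j₁' k₁' j₂' k₂' h =>
    hD _ ⟨i', h, j₁', k₁', j₂', k₂', rfl⟩
  rcases hA (Or.inl (by simp [s₀])) with h | ⟨i, j₁, k₁, j₂, k₂, h1, h2, h3, h4⟩
  · -- The costless action with the contract `0` has nonnegative utility.
    exfalso
    obtain ⟨z, hz⟩ := I.exists_null
    have h1 := hD' z z z z z (hz ▸ I.f_nonneg z)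
    rw [h, Instance.pairCandidate, Instance.candidate_self,
      Instance.breakpoint_self z z (I.f_nonneg z), hz, zero_div, Instance.value,
      Instance.minCost_zero] at h1
    linarith [I.f_nonneg z]
  · exact ⟨i, j₁, k₁, j₂, k₂, h1, h2, h3, fun i' j₁' k₁' j₂' k₂' h => h4 ▸ hD' _ _ _ _ _ h⟩

theorem writeSetProg_spec (s : Store) (x : ℕ) :
    (x < s.nat 11 0 ∨ s.nat 11 0 + n ≤ x → (writeSetProg.run v s).nat 2 x = s.nat 2 x) ∧
    ∀ j : Fin n, x = s.nat 11 0 + j → ((writeSetProg.run v s).nat 2 x ≠ 0 ↔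
      if s.real 8 0 ≤ s.real 7 0 then s.nat 10 j ≠ 0 else j = s.nat 3 0) := by
  have key : (x < s.nat 11 0 ∨ s.nat 11 0 + n ≤ x →
      (writeSetProg.run v s).nat 2 x = s.nat 2 x) ∧
      ∀ j : Fin n, j.val < n → x = s.nat 11 0 + j → ((writeSetProg.run v s).nat 2 x ≠ 0 ↔
        if s.real 8 0 ≤ s.real 7 0 then s.nat 10 j ≠ 0 else j = s.nat 3 0) := by
    refine forN_induction v (fun m st => (x < s.nat 11 0 ∨ s.nat 11 0 + n ≤ x →
      st.nat 2 x = s.nat 2 x) ∧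
      ∀ j : Fin n, j.val < m → x = s.nat 11 0 + j → (st.nat 2 x ≠ 0 ↔
        if s.real 8 0 ≤ s.real 7 0 then s.nat 10 j ≠ 0 else j = s.nat 3 0)) 9 _ s (by simp)
      fun m hm st hk hN hR hinv => ?_
    have h11 := hN 11 (by simp)
    have h10 := hN 10 (by simp)
    have h3 := hN 3 (by simp)
    have h7 := hR 7 (by simp)
    have h8 := hR 8 (by simp)
    have hind := indicator_ne_zero (s := st)
    rw [hk, h3] at hind
    have hout : ∀ y, y = s.nat 11 0 + m → ∀ (C : Prog) (e : NExp),
        C = .setN 2 (.add (.var 11) (.var 9)) e →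
        (C.run v st).nat 2 y = e.eval st ∧ ∀ z ≠ y, (C.run v st).nat 2 z = st.nat 2 z := by
      rintro y rfl C e rfl
      exact ⟨by simp [h11, hk], fun z hz => by simp [h11, hk, hz]⟩
    by_cases ht : s.real 8 0 ≤ s.real 7 0
    · have ht' : (BExp.rle (.var 8) (.var 7)).eval st := by simpa [h7, h8] using ht
      rw [run_ite_of_pos _ _ ht']
      obtain ⟨e1, e2⟩ := hout _ rfl _ _ rfl
      refine ⟨fun hx => ?_, fun j hj hx => ?_⟩
      · exact (e2 x (by omega)).trans (hinv.1 hx)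
      · by_cases hjm : j.val = m
        · have hx' : x = s.nat 11 0 + m := by omega
          subst hx'
          refine Iff.trans (not_congr (Eq.congr_left e1)) ?_
          simp [ht, hk, h10, hjm]
        · refine Iff.trans (not_congr (Eq.congr_left (e2 x (by omega)))) ?_
          exact hinv.2 j (by omega) hx
    · have ht' : ¬ (BExp.rle (.var 8) (.var 7)).eval st := by simpa [h7, h8] using ht
      rw [run_ite_of_neg _ _ ht']
      obtain ⟨e1, e2⟩ := hout _ rfl _ _ rfl
      refine ⟨fun hx => ?_, fun j hj hx => ?_⟩
      · exact (e2 x (by omega)).trans (hinv.1 hx)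
      · by_cases hjm : j.val = m
        · have hx' : x = s.nat 11 0 + m := by omega
          subst hx'
          refine Iff.trans (not_congr (Eq.congr_left e1)) ?_
          rw [if_neg ht, hjm]
          exact hind
        · refine Iff.trans (not_congr (Eq.congr_left (e2 x (by omega)))) ?_
          exact hinv.2 j (by omega) hx
  exact ⟨key.1, fun j hj => key.2 j j.2 hj⟩

theorem outputProg_spec {I : Instance (Fin n)} {s : Store} {i : Fin n} {α : ℝ}
    (hc : ∀ j : Fin n, s.real 0 j = I.c j) (hf : ∀ j : Fin n, s.real 1 j = I.f j)
    (hn : s.nat 0 0 = n) (hi : s.nat 12 0 = i) (hα : s.real 16 0 = α) (h2 : ∀ x, s.nat 2 x = 0)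
    {s' : Store} (hs' : s' = outputProg.run I.v s) :
    s'.nat 1 0 = i ∧ s'.nat 1 1 = n + 1 ∧ s'.real 2 0 = α ∧
      (∀ k : Fin n, s'.readSet n 2 (k * n) = I.outcomeSet Fin.val i α (some k) ∧
        s'.real 3 k = I.outcomeProb Fin.val i α (some k)) ∧
      s'.readSet n 2 (n * n) = ∅ ∧ s'.real 3 n = I.outcomeProb Fin.val i α none := by
  set q := I.required i α
  set sa := Prog.run I.v (.seq (.setN 3 (.const 0) (.var 12)) (.setR 5 (.const 0) (.var 16))) s
  have hia : sa.nat 3 0 = i := by simp [sa, hi]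
  have hαa : sa.real 5 0 = α := by simp [sa, hα]
  set s₁ := Prog.run I.v (.seq (.setN 11 (.const 0) (.const 0)) (.setR 17 (.const 0) (.const 0)))
    (singletonProg.run I.v (requiredProg.run I.v sa))
  have hq : ∀ j : Fin n, s₁.real 4 j = q j := fun j => by
    have := requiredProg_spec I.v (I := I) (s := sa) (by simpa [sa]) (by simpa [sa]) hia hαa j
    simpa [s₁] using this
  have h7 : s₁.real 7 0 = I.v {i} := by
    have := singletonProg_spec I.v (s := requiredProg.run I.v sa) (by simpa using hia)
    simpa [s₁] using this
  have h3 : s₁.nat 3 0 = i := by simpa [s₁] using hia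
  have hn₁ : s₁.nat 0 0 = n := by simpa [s₁, sa] using hn
  have h2₁ : ∀ x, s₁.nat 2 x = 0 := by simpa [s₁, sa] using h2
  have h5₁ : s₁.real 5 0 = α := by simpa [s₁] using hαa
  set body : Prog := .seq segmentProg <|
    .seq (.setR 3 (.var 8) (.sub (.get 4 (.var 8)) (.var 6))) <|
    .seq (.setR 17 (.const 0) (.add (.var 17) (.get 3 (.var 8)))) <|
    .seq writeSetProg <| .setN 11 (.const 0) (.add (.var 11) (.var 0)) with hbody
  set s₂ := (Prog.forN 8 body).run I.v s₁ with hs₂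
  have hloop : s₂.nat 11 0 = n * n ∧ (∀ x, n * n ≤ x → s₂.nat 2 x = 0) ∧
      s₂.real 17 0 = (∑ k : Fin n with k.val < n, I.outcomeProb Fin.val i α (some k)) ∧
      ∀ k : Fin n, k.val < n →
        s₂.readSet n 2 (k * n) = I.outcomeSet Fin.val i α (some k) ∧
        s₂.real 3 k = I.outcomeProb Fin.val i α (some k) := by
    refine forN_induction I.v (fun m st => st.nat 11 0 = m * n ∧
      (∀ x, m * n ≤ x → st.nat 2 x = 0) ∧
      st.real 17 0 = (∑ k : Fin n with k.val < m, I.outcomeProb Fin.val i α (some k)) ∧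
      ∀ k : Fin n, k.val < m →
        st.readSet n 2 (k * n) = I.outcomeSet Fin.val i α (some k) ∧
        st.real 3 k = I.outcomeProb Fin.val i α (some k)) 8 _ s₁
      ⟨by simp [s₁], fun x _ => by simpa using h2₁ x, by simp [s₁], by simp⟩
      fun m hm st hk hN hR hinv => ?_
    obtain ⟨i1, i2, i3, i4⟩ := hinv
    have e4 := hR 4 (by simp [hbody])
    have e7 := hR 7 (by simp [hbody])
    have e3 := hN 3 (by simp [hbody])
    have e0 := hN 0 (by simp [hbody])
    obtain ⟨g1, g2, g3⟩ := segmentProg_spec I.v (s := st) (q := q) (k := ⟨m, hm⟩)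
      (fun j => by rw [e4, hq]) hk
    have hqm : st.real 4 m = q ⟨m, hm⟩ := by rw [e4, ← hq]
    set t := Prog.run I.v (.seq (.setR 3 (.var 8) (.sub (.get 4 (.var 8)) (.var 6)))
      (.setR 17 (.const 0) (.add (.var 17) (.get 3 (.var 8))))) (segmentProg.run I.v st) with ht
    have t11 : t.nat 11 0 = m * n := by simpa [t] using i1
    have t0 : t.nat 0 0 = n := by simpa [t, e0] using hn₁
    have t3 : t.nat 3 0 = i := by simpa [t, e3] using h3
    have t2 : t.nat 2 = st.nat 2 := by simp [t]
    have t10 : t.nat 10 = (segmentProg.run I.v st).nat 10 := by simp [t]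
    have t8 : t.real 8 0 = _ := (by simp [t] : t.real 8 0 = _).trans g3
    have t7 : t.real 7 0 = I.v {i} := by simpa [t, e7] using h7
    have tr3 : ∀ k, t.real 3 k = if k = m then I.outcomeProb Fin.val i α (some ⟨m, hm⟩) else
        st.real 3 k := by
      intro k
      simp [t, hk, hqm, g2, Instance.outcomeProb, q]
    have t17 : t.real 17 0 = st.real 17 0 + I.outcomeProb Fin.val i α (some ⟨m, hm⟩) := by
      simp [t, hk, hqm, g2, Instance.outcomeProb, q]
    set u := writeSetProg.run I.v t with hu
    have hbodyrun : (body.run I.v st).writeN 8 0 (m + 1) =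
      (Prog.run I.v (.setN 11 (.const 0) (.add (.var 11) (.var 0))) u).writeN 8 0 (m + 1) := rfl
    rw [hbodyrun]
    have hread : ∀ o, ((Prog.run I.v (.setN 11 (.const 0) (.add (.var 11) (.var 0))) u).writeN
        8 0 (m + 1)).readSet n 2 o = u.readSet n 2 o := by
      intro o
      simp [Store.readSet]
    simp only [hread]
    have hw := writeSetProg_spec I.v t
    rw [t11] at hw
    refine ⟨?_, fun x hx => ?_, ?_, fun k hk' => ?_⟩
    · simp [u, t11, t0]
      ring
    · have hx' : m * n + n ≤ x := by linarith
      have := (hw x).1 (Or.inr hx')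
      rw [t2, i2 x (by omega)] at this
      simpa [u] using this
    · rw [sum_val_lt_succ _ hm, ← i3, ← t17]
      simp [u]
    · by_cases hkm : k.val = m
      · obtain rfl : k = ⟨m, hm⟩ := Fin.ext hkm
        constructor
        · ext j
          have := (hw (m * n + j)).2 j rfl
          rw [t8, t7, t10, t3] at this
          simp only [Store.readSet, Finset.mem_filter, Finset.mem_univ, true_and]
          refine this.trans ?_
          simp only [Instance.outcomeSet]
          split_ifs
          · rw [g1]
            simp [q]
          · simp [Fin.ext_iff]
        · simpa [u] using tr3 m
      · have hkm' : k.val < m := by omega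
        obtain ⟨j1, j2⟩ := i4 k hkm'
        constructor
        · rw [← j1]
          ext j
          have hlt : k * n + j < m * n := by
            have : (k.val + 1) * n ≤ m * n := Nat.mul_le_mul_right n hkm'
            have := j.2
            linarith
          have := (hw (k * n + j)).1 (Or.inl hlt)
          simp only [Store.readSet, Finset.mem_filter, Finset.mem_univ, true_and]
          rw [this, t2]
        · have := tr3 k
          rw [if_neg hkm, j2] at this
          simpa [u] using this
  obtain ⟨l1, l2, l3, l4⟩ := hloop
  have f0 : s₂.nat 0 0 = n := by
    rw [hs₂, run_nat _ _ _ (by simp [hbody])]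
    exact hn₁
  have f3 : s₂.nat 3 0 = i := by
    rw [hs₂, run_nat _ _ _ (by simp [hbody])]
    exact h3
  have f5 : s₂.real 5 0 = α := by
    rw [hs₂, run_real _ _ _ (by simp [hbody])]
    exact h5₁
  have hs'₂ : s' = Prog.run I.v (.seq (.setR 3 (.var 0) (.sub (.const 1) (.var 17))) <|
      .seq (.setR 2 (.const 0) (.var 5)) <|
      .seq (.setN 1 (.const 0) (.var 3)) <| .setN 1 (.const 1) (.add (.var 0) (.const 1))) s₂ :=
    hs'
  have hread : ∀ o, s'.readSet n 2 o = s₂.readSet n 2 o := by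
    intro o
    simp [hs'₂, Store.readSet]
  refine ⟨by simp [hs'₂, f3], by simp [hs'₂, f0], by simp [hs'₂, f5], fun k => ?_, ?_, ?_⟩
  · rw [hread]
    refine ⟨(l4 k k.2).1, ?_⟩
    rw [← (l4 k k.2).2]
    simp [hs'₂, f0, k.2.ne]
  · rw [hread]
    ext j
    simp [Store.readSet, l2 (n * n + j) (by omega)]
  · simp [hs'₂, f0, l3]
    simp [Instance.outcomeProb]

theorem countersSafe_seq_searchProg_outputProg :
    (Prog.seq searchProg outputProg).CountersSafe := by
  simp [CountersSafe, searchProg, outputProg, candidateProg, breakpointProg, costProg,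
    segmentProg, singletonProg, requiredProg, writeSetProg]

/-- The program that searches the candidates and writes the best scheme is correct; its running
time is bounded by the polynomial read off its text. -/
theorem exec_searchProg_outputProg {I : Instance (Fin n)} (hv : IsSubmodular I.v) :
    ∃ (t : ℕ) (s : Store) (σ : Scheme (Fin n)) (m : ℕ),
      Exec I.v (Prog.seq searchProg outputProg).code I.input t s ∧
      t ≤ (Prog.seq searchProg outputProg).time.eval n ∧
      s.Describes σ m ∧ m ≤ n + 1 ∧
      I.IsOptimalIC σ ∧ (Function.support σ.p).ncard ≤ n + 1 := by
  have hc : ∀ j : Fin n, I.input.real 0 j = I.c j := fun j => by simp [Instance.input]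
  have hf : ∀ j : Fin n, I.input.real 1 j = I.f j := fun j => by simp [Instance.input]
  have hn : I.input.nat 0 0 = n := by simp [Instance.input]
  obtain ⟨t, ht, hexec⟩ := exec_code I.v (.seq searchProg outputProg)
    countersSafe_seq_searchProg_outputProg (by decide) I.input hn
  obtain ⟨i, j₁, k₁, j₂, k₂, hif, hi, hα, hmax⟩ := searchProg_spec hc hf
  obtain ⟨h1, h2, h3⟩ := Instance.candidate_bounds
    (α := I.pairCandidate i j₁ k₁ j₂ k₂) hif j₁ k₁ j₂ k₂ rfl
  have hr0 : (searchProg.run I.v I.input).real 0 = I.input.real 0 := run_real _ _ _ (by decide)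
  have hr1 : (searchProg.run I.v I.input).real 1 = I.input.real 1 := run_real _ _ _ (by decide)
  have hn0 : (searchProg.run I.v I.input).nat 0 = I.input.nat 0 := run_nat _ _ _ (by decide)
  have hn2 : (searchProg.run I.v I.input).nat 2 = I.input.nat 2 := run_nat _ _ _ (by decide)
  obtain ⟨o1, o2, o3, o4, o5, o6⟩ := outputProg_spec (s := searchProg.run I.v I.input)
    (by rwa [hr0]) (by rwa [hr1]) (by rwa [hn0]) hi hα
    (fun x => by rw [hn2]; simp [Instance.input]) rfl
  refine ⟨t, _, I.bestScheme Fin.val Fin.val_injective i _ h1 h2 h3, n + 1, hexec, ht,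
    ⟨o1, o2, o3, fun S => ?_⟩, le_rfl, Instance.bestScheme_isOptimalIC hv _ h1 h2 h3 hmax,
    (I.support_policy Fin.val i _).trans_eq (by simp)⟩
  change I.policy Fin.val i _ S = _
  rw [Finset.sum_range_succ, Finset.sum_range, Instance.policy, Fintype.sum_option, add_comm,
    run_seq, o5, o6]
  refine congrArg₂ (· + ·) (Finset.sum_congr rfl fun k _ => ?_) rfl
  rw [(o4 k).1, (o4 k).2]

end Program

end Inspection

theorem theorem2 :
    (∀ (A : Type*) [Fintype A] [DecidableEq A] (I : Inspection.Instance A),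
      Inspection.IsSubmodular I.v →
        ∃ σ : Inspection.Scheme A, I.IsOptimalIC σ ∧
          (Function.support σ.p).ncard ≤ Fintype.card A + 1) ∧
    ∃ (C : Inspection.Cmd) (T : Polynomial ℕ),
      ∀ (n : ℕ) (I : Inspection.Instance (Fin n)), Inspection.IsSubmodular I.v →
        ∃ (t : ℕ) (s : Inspection.Store) (σ : Inspection.Scheme (Fin n)) (m : ℕ),
          Inspection.Exec I.v C I.input t s ∧ t ≤ T.eval n ∧
          s.Describes σ m ∧ m ≤ n + 1 ∧
          I.IsOptimalIC σ ∧ (Function.support σ.p).ncard ≤ n + 1 := by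
  exact ⟨fun A _ _ I hv => Inspection.Instance.exists_isOptimalIC hv,
    _, _, fun n I hv => Inspection.exec_searchProg_outputProg hv⟩
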